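/- Let $(\Omega,\mathcal F,\mathbb P)$ be a complete probability space and let $(\gamma_t)_{t\ge 0}$ be a standard gamma process on it, that is, a driftless subordinator with $\gamma_0=0$ a.s. and $\mathbb E[e^{-\lambda\gamma_t}]=\exp\bigl(-t\int_0^\infty(1-e^{-\lambda x})\frac{e^{-x}}{x}\,dx\bigr)$ for all $t,\lambda\ge 0$. Let $\tau:\Omega\to(0,\infty)$ be a random time independent of $\gamma$, with law $\mathbb P_\tau$. For $r>0$ let $\zeta^r_t=\gamma_{t\wedge r}/\gamma_r$ ($t\ge 0$) be the gamma bridge of length $r$, let $\zeta_t=\gamma_{t\wedge\tau}/\gamma_\tau$ be the gamma bridge of random length $\tau$, and let $\mathcal F^{\zeta,c}_t=\sigma(\zeta_s,\ s\le t)\vee\mathcal N$, where $\mathcal N$ is the collection of $\mathbb P$-null sets. For $0<t<r$ let $$\varphi_{\zeta^r_t}(x)=\frac{\Gamma(r)}{\Gamma(t)\Gamma(r-t)}\,x^{t-1}(1-x)^{r-t-1}\,\mathbb I_{(0,1)}(x),\qquad \phi_{\zeta^r_t}(x)=\frac{\varphi_{\zeta^r_t}(x)}{\int_{(t,\infty)}\varphi_{\zeta^s_t}(x)\,\mathbb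 P_\tau(ds)},$$ and for $0<t<u<r$ and $x\in(0,1)$ let $$\mathbb P_{\zeta^r_u\mid\zeta^r_t=x}(dy)=\frac{\Gamma(r-t)}{\Gamma(u-t)\Gamma(r-u)}\,\frac{(y-x)^{u-t-1}(1-y)^{r-u-1}}{(1-x)^{r-t-1}}\,\mathbb I_{\{x<y<1\}}\,dy .$$ Let $0<t<u$. (i) For every bounded measurable $g:(0,\infty)\to\mathbb R$, $\mathbb P$-a.s., $$\mathbb E[g(\tau)\mid\mathcal F^{\zeta,c}_t]=g(\tau\wedge t)\,\mathbb I_{\{\zeta_t=1\}}+\int_{(t,\infty)}g(r)\,\phi_{\zeta^r_t}(\zeta_t)\,\mathbb P_\tau(dr)\,\mathbb I_{\{0<\zeta_t<1\}} .$$ (ii) For every bounded measurable $g:(0,\infty)\times\mathbb R\to\mathbb R$, $\mathbb P$-a.s., $$\mathbb E[g(\tau,\zeta_t)\mid\mathcal F^{\zeta,c}_t]=g(\tau\wedge t,1)\,\mathbb I_{\{\zeta_t=1\}}+\int_{(t,\infty)}g(r,\zeta_t)\,\phi_{\zeta^r_t}(\zeta_t)\,\mathbb P_\tau(dr)\,\mathbb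 I_{\{0<\zeta_t<1\}}$$ and $$\begin{aligned}\mathbb E[g(\tau,\zeta_u)\mid\mathcal F^{\zeta,c}_t]={}&g(\tau\wedge t,1)\,\mathbb I_{\{\zeta_t=1\}}+\int_{(t,u]}g(r,1)\,\phi_{\zeta^r_t}(\zeta_t)\,\mathbb P_\tau(dr)\,\mathbb I_{\{0<\zeta_t<1\}}\\&+\int_{(u,\infty)}\Bigl(\int_{\mathbb R}g(r,y)\,\mathbb P_{\zeta^r_u\mid\zeta^r_t=x}(dy)\Big|_{x=\zeta_t}\Bigr)\,\phi_{\zeta^r_t}(\zeta_t)\,\mathbb P_\tau(dr)\,\mathbb I_{\{0<\zeta_t<1\}} .\end{aligned}$$ -/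

import Mathlib

open MeasureTheory ProbabilityTheory
open scoped NNReal

/-- `γ` is a standard gamma process under `μ`: a subordinator (a real process started at `0`, with
independent and stationary increments and almost surely nondecreasing right-continuous paths) whose
Laplace transform has the Lévy-Khintchine form with zero drift and Lévy measure
`x⁻¹ e⁻ˣ dx` on `(0, ∞)`. Left limits exist automatically, the paths being nondecreasing. -/
structure IsStandardGammaProcess {Ω : Type*} [MeasurableSpace Ω]
    (γ : ℝ≥0 → Ω → ℝ) (μ : Measure Ω) : Prop where
  measurable : ∀ t, Measurable (γ t)
  zero : ∀ᵐ ω ∂μ, γ 0 ω = 0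
  indep_increments : HasIndepIncrements γ μ
  stationary_increments : ∀ s h : ℝ≥0,
    IdentDistrib (fun ω => γ (s + h) ω - γ s ω) (γ h) μ μ
  monotone_paths : ∀ᵐ ω ∂μ, Monotone fun t => γ t ω
  rightContinuous_paths : ∀ᵐ ω ∂μ, ∀ t, ContinuousWithinAt (fun s => γ s ω) (Set.Ici t) t
  laplace : ∀ (t : ℝ≥0) (l : ℝ), 0 ≤ l →
    ∫ ω, Real.exp (-l * γ t ω) ∂μ =
      Real.exp (-(t : ℝ) *
        ∫ x in Set.Ioi (0 : ℝ), (1 - Real.exp (-l * x)) * (Real.exp (-x) / x))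

/-- The gamma bridge of deterministic length `r`: `ζʳ_t = γ_{t ∧ r} / γ_r`. -/
noncomputable def gammaBridge {Ω : Type*} (γ : ℝ≥0 → Ω → ℝ) (r t : ℝ≥0) (ω : Ω) : ℝ :=
  γ (min t r) ω / γ r ω

/-- The gamma bridge of random length `τ`: `ζ_t = ζʳ_t` at `r = τ`. -/
noncomputable def randomGammaBridge {Ω : Type*} (γ : ℝ≥0 → Ω → ℝ) (τ : Ω → ℝ≥0)
    (t : ℝ≥0) (ω : Ω) : ℝ :=
  gammaBridge γ (τ ω) t ω

/-- The completed natural filtration `σ(Y_s, s ≤ t) ∨ 𝒩` of a real process `Y`, with `𝒩` the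
`μ`-null sets. -/
def completedNatural {Ω : Type*} [MeasurableSpace Ω] (Y : ℝ≥0 → Ω → ℝ) (μ : Measure Ω)
    (t : ℝ≥0) : MeasurableSpace Ω :=
  (⨆ s : ℝ≥0, ⨆ _ : s ≤ t, MeasurableSpace.comap (Y s) inferInstance) ⊔
    MeasurableSpace.generateFrom {N : Set Ω | μ N = 0}

/-- The density of `ζʳ_t` for `0 < t < r`, that is, of the beta distribution `β(t, r - t)`. -/
noncomputable def bridgeDensity (t r x : ℝ) : ℝ :=
  betaPDFReal t (r - t) x

/-- The density of `ζʳ_t` at `x`, divided by its integral over lengths in `(t, ∞)` under the law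
`Pτ` of the random length. -/
noncomputable def bayesWeight (Pτ : Measure ℝ≥0) (t r : ℝ≥0) (x : ℝ) : ℝ :=
  bridgeDensity t r x / ∫ s in Set.Ioi t, bridgeDensity t s x ∂Pτ

/-- The conditional law of `ζʳ_u` given `ζʳ_t = x`, for `0 < t < u < r` and `x ∈ (0, 1)`. -/
noncomputable def bridgeTransition (t u r x : ℝ) : Measure ℝ :=
  volume.withDensity fun y => ENNReal.ofReal <|
    (Set.Ioo x 1).indicator
      (fun y => Real.Gamma (r - t) / (Real.Gamma (u - t) * Real.Gamma (r - u)) *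
        ((y - x) ^ (u - t - 1) * (1 - y) ^ (r - u - 1) / (1 - x) ^ (r - t - 1))) y

/-! The argument rests on one independence: for a gamma process, the rescaled past `γ_s / γ_t`, `s ≤
t`, is independent of `γ_t`, of the increments after `t` and of `τ` together (`indepFun_bridge`). On
`{t < τ}` one has `ζ_s = (γ_s / γ_t) ζ_t`, so the past of the bridge is a function of this
independent piece and of `ζ_t`, while `τ`, `ζ_t` and `ζ_u` depend only on the other variables.
Conditioning on the past therefore reduces to conditioning on `ζ_t` alone
(`setIntegral_past_eq_zero`).

Given `τ = r > t`, the bridge at `t` has a beta law, so on `{t < τ}` the pair `(τ, ζ_t)` has density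
`bridgeDensity t r x` with respect to `Pτ(dr) dx`, and Bayes' formula gives the conditional law of
`τ` (`setIntegral_sub_bayesMean`). For the future with `u < r`, `ζʳ_u = ζʳ_t + (1 - ζʳ_t) B` with
`B` an independent beta variable (`bridge_increment`).

On `{τ ≤ t}` nothing is random: paths are strictly increasing, so `ζ_s = 1` exactly when `τ ≤ s`,
and `τ ∧ t` is known at time `t` up to null sets.

The independence comes from Laplace transforms: tilting independent gamma variables of rate one by
`exp (-l * sum)` amounts to rescaling them, which scale invariant functions do not see. -/

section

open scoped BoundedContinuousFunction ENNReal

/-! ### Uniqueness of Laplace transforms on the half-line -/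

section LaplaceUniqueness

/-- The function `x ↦ e⁻ˣ` on `[0, ∞)`, as a bounded continuous function. -/
noncomputable def expNegBCF : ℝ≥0 →ᵇ ℝ :=
  BoundedContinuousFunction.ofNormedAddCommGroup (fun x : ℝ≥0 => Real.exp (-(x : ℝ)))
    (by fun_prop) 1 (fun x => by simp)

lemma expNegBCF_apply (x : ℝ≥0) : expNegBCF x = Real.exp (-(x : ℝ)) := rfl

lemma integral_aeval_expNegBCF {μ ν : Measure ℝ≥0} [IsFiniteMeasure μ] [IsFiniteMeasure ν]
    (h : ∀ n : ℕ, ∫ x, Real.exp (-n * (x : ℝ)) ∂μ = ∫ x, Real.exp (-n * (x : ℝ)) ∂ν)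
    (p : Polynomial ℝ) :
    ∫ x, Polynomial.aeval expNegBCF p x ∂μ = ∫ x, Polynomial.aeval expNegBCF p x ∂ν := by
  induction p using Polynomial.induction_on' with
  | add p q hp hq =>
    simp only [map_add, BoundedContinuousFunction.coe_add, Pi.add_apply]
    rw [integral_add (BoundedContinuousFunction.integrable _ _)
      (BoundedContinuousFunction.integrable _ _), hp, hq,
      integral_add (BoundedContinuousFunction.integrable _ _)
      (BoundedContinuousFunction.integrable _ _)]
  | monomial n a =>
    have : ∀ x : ℝ≥0, Polynomial.aeval expNegBCF (Polynomial.monomial n a) x =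
        a * Real.exp (-n * (x : ℝ)) := by
      intro x
      rw [Polynomial.aeval_monomial, BoundedContinuousFunction.mul_apply,
        BoundedContinuousFunction.pow_apply, expNegBCF_apply, ← Real.exp_nat_mul]
      congr 2
      simp
    simp_rw [this, integral_const_mul, h]

/-- Finite measures on `[0, ∞)` with the same Laplace transform at the integers are equal. -/
lemma Measure.ext_of_laplace_nnreal {μ ν : Measure ℝ≥0} [IsFiniteMeasure μ] [IsFiniteMeasure ν]
    (h : ∀ n : ℕ, ∫ x, Real.exp (-n * (x : ℝ)) ∂μ = ∫ x, Real.exp (-n * (x : ℝ)) ∂ν) :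
    μ = ν := by
  -- Polynomials in `e⁻ˣ` form an algebra separating points, and their integrals are combinations of
  -- Laplace transforms at integers.
  let A : StarSubalgebra ℝ (ℝ≥0 →ᵇ ℝ) :=
    { Algebra.adjoin ℝ {expNegBCF} with
      star_mem' := fun {a} ha => by
        have : star a = a := by ext x; simp
        rw [this]; exact ha }
  refine ext_of_forall_mem_subalgebra_integral_eq_of_polish (𝕜 := ℝ) (A := A) ?_ ?_
  · intro x y hxy
    refine ⟨fun x => Real.exp (-(x : ℝ)), ⟨_, ⟨expNegBCF, ?_, rfl⟩, rfl⟩, ?_⟩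
    · exact Algebra.subset_adjoin rfl
    · simpa using hxy
  · intro g hg
    have hg' : g ∈ Algebra.adjoin ℝ {expNegBCF} := hg
    rw [Algebra.adjoin_singleton_eq_range_aeval] at hg'
    obtain ⟨p, rfl⟩ := hg'
    exact integral_aeval_expNegBCF h p

/-- Finite measures on `ℝ` concentrated on `[0, ∞)` with the same Laplace transform are equal. -/
lemma Measure.ext_of_laplace {μ ν : Measure ℝ} [IsFiniteMeasure μ] [IsFiniteMeasure ν]
    (hμ : ∀ᵐ x ∂μ, 0 ≤ x) (hν : ∀ᵐ x ∂ν, 0 ≤ x)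
    (h : ∀ l : ℝ, 0 ≤ l → ∫ x, Real.exp (-l * x) ∂μ = ∫ x, Real.exp (-l * x) ∂ν) :
    μ = ν := by
  have key : ∀ m : Measure ℝ, (∀ᵐ x ∂m, 0 ≤ x) →
      (m.map Real.toNNReal).map ((↑) : ℝ≥0 → ℝ) = m := by
    intro m hm
    rw [Measure.map_map (by fun_prop) (by fun_prop)]
    conv_rhs => rw [← Measure.map_id (μ := m)]
    refine Measure.map_congr ?_
    filter_upwards [hm] with x hx
    simp [hx]
  rw [← key μ hμ, ← key ν hν]
  congr 1
  refine Measure.ext_of_laplace_nnreal fun n => ?_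
  have key2 : ∀ m : Measure ℝ, (∀ᵐ x ∂m, 0 ≤ x) →
      ∫ x, Real.exp (-n * (x : ℝ)) ∂(m.map Real.toNNReal) = ∫ x, Real.exp (-n * x) ∂m := by
    intro m hm
    rw [integral_map (by fun_prop) (by fun_prop)]
    refine integral_congr_ae ?_
    filter_upwards [hm] with x hx
    simp [hx]
  rw [key2 μ hμ, key2 ν hν, h n (by positivity)]

end LaplaceUniqueness

/-! ### Gamma laws: tilting, scaling, Lévy–Khintchine exponent -/

section GammaLaw

lemma ae_pos_gammaMeasure (a r : ℝ) : ∀ᵐ x ∂gammaMeasure a r, 0 < x := by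
  rw [gammaMeasure, ae_withDensity_iff (by unfold gammaPDF; fun_prop)]
  have : ∀ᵐ x : ℝ, x ≠ 0 := by simp [ae_iff]
  filter_upwards [this] with x hx h
  by_contra hn
  exact h (gammaPDF_of_neg (lt_of_le_of_ne (not_lt.mp hn) hx))

/-- Exponential tilting maps gamma laws to gamma laws. -/
lemma gammaMeasure_withDensity_exp {a r l : ℝ} (ha : 0 < a) (hr : 0 < r) (hl : 0 ≤ l) :
    (gammaMeasure a r).withDensity (fun x => ENNReal.ofReal (Real.exp (-l * x))) =
      ENNReal.ofReal ((r / (r + l)) ^ a) • gammaMeasure a (r + l) := by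
  have hm : ∀ r, Measurable (gammaPDF a r) := fun r => by unfold gammaPDF; fun_prop
  rw [gammaMeasure, ← withDensity_mul _ (hm r) (by fun_prop), gammaMeasure,
    ← withDensity_smul _ (hm _)]
  congr 1
  ext x
  simp only [Pi.mul_apply, Pi.smul_apply, smul_eq_mul, gammaPDF]
  have hp : (0 : ℝ) ≤ (r / (r + l)) ^ a := by positivity
  rw [← ENNReal.ofReal_mul' (by positivity), ← ENNReal.ofReal_mul hp]
  congr 1
  unfold gammaPDFReal
  split_ifs with h
  · have : Real.exp (-((r + l) * x)) = Real.exp (-(r * x)) * Real.exp (-l * x) := by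
      rw [← Real.exp_add]; ring_nf
    rw [this, Real.div_rpow hr.le (by positivity)]
    have : (r + l) ^ a ≠ 0 := (Real.rpow_pos_of_pos (by positivity) _).ne'
    field_simp
  · simp

lemma integral_exp_gammaMeasure {a r l : ℝ} (ha : 0 < a) (hr : 0 < r) (hl : 0 ≤ l) :
    ∫ x, Real.exp (-l * x) ∂gammaMeasure a r = (r / (r + l)) ^ a := by
  have : IsProbabilityMeasure (gammaMeasure a (r + l)) :=
    isProbabilityMeasure_gammaMeasure ha (by positivity)
  have h := congrArg (fun m => m Set.univ) (gammaMeasure_withDensity_exp ha hr hl)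
  simp only [MeasurableSet.univ, withDensity_apply, Measure.restrict_univ, Measure.smul_apply,
    measure_univ, smul_eq_mul, mul_one] at h
  rw [integral_eq_lintegral_of_nonneg_ae (by filter_upwards with x; positivity) (by fun_prop), h,
    ENNReal.toReal_ofReal (by positivity)]

/-- Scaling of gamma laws. -/
lemma gammaMeasure_map_div {a r : ℝ} (ha : 0 < a) (hr : 0 < r) :
    (gammaMeasure a 1).map (fun x => x / r) = gammaMeasure a r := by
  have := isProbabilityMeasure_gammaMeasure ha one_pos
  have := isProbabilityMeasure_gammaMeasure ha hr
  refine Measure.ext_of_laplace ?_ ((ae_pos_gammaMeasure a r).mono fun x hx => hx.le) fun l hl => ?_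
  · rw [ae_map_iff (by fun_prop) measurableSet_Ici]
    filter_upwards [ae_pos_gammaMeasure a 1] with x hx
    positivity
  · rw [integral_map (by fun_prop) (by fun_prop)]
    have : ∀ x : ℝ, -l * (x / r) = -(l / r) * x := fun x => by ring
    simp_rw [this]
    rw [integral_exp_gammaMeasure ha one_pos (by positivity), integral_exp_gammaMeasure ha hr hl]
    congr 1
    field_simp

/-- The Lévy–Khintchine exponent of the standard gamma process. -/
lemma integral_gamma_levy {l : ℝ} (hl : 0 ≤ l) :
    ∫ x in Set.Ioi (0 : ℝ), (1 - Real.exp (-l * x)) * (Real.exp (-x) / x) = Real.log (1 + l) := by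
  have hcont : Continuous fun x : ℝ => Real.exp (-x) := by fun_prop
  -- The integrand is `(e⁻ˣ - e^{-(1+l)x}) / x`, a Frullani integral whose value is `log (1 + l)`.
  have h := Frullani.integral_Ioi_eq (f := fun x : ℝ => Real.exp (-x)) (L := 1) (R := 0)
    (a := 1) (b := 1 + l) (hcont.locallyIntegrable.locallyIntegrableOn _) one_pos (by positivity)
    ?_ Real.tendsto_exp_neg_atTop_nhds_zero ?_
  · simp only [div_one, sub_zero, smul_eq_mul, mul_one] at h
    rw [← h]
    refine setIntegral_congr_fun measurableSet_Ioi fun x hx => ?_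
    have : Real.exp (-((1 + l) * x)) = Real.exp (-x) * Real.exp (-l * x) := by
      rw [← Real.exp_add]; ring_nf
    simp only [one_mul, this]
    ring
  · have := hcont.tendsto 0
    simp only [neg_zero, Real.exp_zero] at this
    exact this.mono_left nhdsWithin_le_nhds
  -- The dominating function comes from `1 - e^{-lx} ≤ lx`.
  · have hint : IntegrableOn (fun x : ℝ => l * Real.exp (-x)) (Set.Ioi 0) :=
      (integrableOn_exp_neg_Ioi 0).const_mul l
    refine Integrable.mono' hint ?_ ?_
    · exact Measurable.aestronglyMeasurable (by fun_prop)
    · filter_upwards [ae_restrict_mem measurableSet_Ioi] with x hx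
      have hx : 0 < x := hx
      have h1 : Real.exp (-((1 + l) * x)) = Real.exp (-x) * Real.exp (-(l * x)) := by
        rw [← Real.exp_add]; ring_nf
      have h2 : Real.exp (-(l * x)) ≤ 1 := by simp; positivity
      have h3 := Real.add_one_le_exp (-(l * x))
      rw [one_mul, h1, smul_eq_mul, Real.norm_of_nonneg]
      · rw [inv_mul_le_iff₀ hx]
        nlinarith [Real.exp_pos (-x)]
      · have : 0 ≤ 1 - Real.exp (-(l * x)) := by linarith
        have : 0 ≤ Real.exp (-x) - Real.exp (-x) * Real.exp (-(l * x)) := by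
          nlinarith [Real.exp_pos (-x)]
        positivity

end GammaLaw

end

/-! ### Beta–gamma algebra for two variables -/

section

open scoped ENNReal

/-- This is the density identity for the substitution `x = s v`, `w = s (1 - v)`, whose Jacobian is
`s`. The endpoints are excluded because the gamma density is supported on a closed half-line and the
beta density on an open interval. -/
lemma gammaPDFReal_mul_scaled {a b s v : ℝ} (ha : 0 < a) (hb : 0 < b) (hs : 0 < s)
    (hv0 : v ≠ 0) (hv1 : v ≠ 1) :
    s * (gammaPDFReal a 1 (s * v) * gammaPDFReal b 1 (s - s * v)) =
      betaPDFReal a b v * gammaPDFReal (a + b) 1 s := by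
  unfold gammaPDFReal betaPDFReal
  rcases lt_or_gt_of_ne hv0 with h0 | h0
  · rw [if_neg (show ¬ 0 ≤ s * v by nlinarith)]
    simp [h0.not_gt]
  rcases lt_or_gt_of_ne hv1 with h1 | h1
  · have hv : 0 < 1 - v := by linarith
    rw [if_pos (by positivity), if_pos (by nlinarith), if_pos ⟨h0, h1⟩, if_pos hs.le]
    have e1 : s - s * v = s * (1 - v) := by ring
    rw [e1, Real.mul_rpow hs.le h0.le, Real.mul_rpow hs.le hv.le]
    have e2 : s ^ (a + b - 1) = s * (s ^ (a - 1) * s ^ (b - 1)) := by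
      nth_rewrite 2 [← Real.rpow_one s]
      rw [← Real.rpow_add hs, ← Real.rpow_add hs]
      ring_nf
    have e3 : Real.exp (-(1 * s)) = Real.exp (-(1 * (s * v))) * Real.exp (-(1 * (s * (1 - v)))) := by
      rw [← Real.exp_add]; ring_nf
    rw [e2, e3, beta]
    have := (Real.Gamma_pos_of_pos ha).ne'
    have := (Real.Gamma_pos_of_pos hb).ne'
    have := (Real.Gamma_pos_of_pos (add_pos ha hb)).ne'
    simp only [Real.one_rpow]
    field_simp
  · rw [if_neg (show ¬ (0 ≤ s - s * v) by nlinarith), if_neg (show ¬ (0 < v ∧ v < 1) by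
      intro h; linarith [h.2])]
    simp

lemma lintegral_scale {s : ℝ} (hs : 0 < s) {f : ℝ → ℝ≥0∞} (hf : Measurable f) :
    ∫⁻ x, f x = ENNReal.ofReal s * ∫⁻ v, f (s * v) := by
  conv_lhs => rw [← Real.smul_map_volume_mul_left hs.ne']
  rw [lintegral_smul_measure, lintegral_map hf (by fun_prop), abs_of_pos hs, smul_eq_mul]

@[fun_prop]
lemma measurable_gammaPDF (a r : ℝ) : Measurable (gammaPDF a r) := by unfold gammaPDF; fun_prop

@[fun_prop]
lemma measurable_betaPDF (a b : ℝ) : Measurable (betaPDF a b) := by unfold betaPDF; fun_prop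

/-- For independent gamma variables with the same rate, the proportion of the first one in the sum
has a beta law, and is independent of the sum, which has a gamma law. -/
lemma map_gamma_prod_gamma {a b : ℝ} (ha : 0 < a) (hb : 0 < b) :
    ((gammaMeasure a 1).prod (gammaMeasure b 1)).map (fun p => (p.1 / (p.1 + p.2), p.1 + p.2)) =
      (betaMeasure a b).prod (gammaMeasure (a + b) 1) := by
  have := isProbabilityMeasure_gammaMeasure ha one_pos
  have := isProbabilityMeasure_gammaMeasure hb one_pos
  have := isProbabilityMeasure_gammaMeasure (add_pos ha hb) one_pos
  have := isProbabilityMeasureBeta ha hb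
  refine Measure.ext_of_lintegral _ fun f hf => ?_
  rw [lintegral_map hf (by fun_prop), lintegral_prod _ (by fun_prop)]
  rw [lintegral_prod_symm _ (by fun_prop)]
  simp only [gammaMeasure, betaMeasure]
  rw [lintegral_withDensity_eq_lintegral_mul _ (by fun_prop) (by
      apply Measurable.lintegral_prod_right' (f := fun p : ℝ × ℝ =>
        f (p.1 / (p.1 + p.2), p.1 + p.2)); fun_prop)]
  rw [lintegral_withDensity_eq_lintegral_mul _ (by fun_prop) (by
      apply Measurable.lintegral_prod_left'; fun_prop)]
  simp only [Pi.mul_apply]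
  -- For fixed `x`, the sum `s = x + w` becomes the variable; after the exchange of integrals, `x =
  -- s v` is substituted.
  have e1 : ∀ x, ∫⁻ w, f (x / (x + w), x + w) ∂volume.withDensity (gammaPDF b 1) =
      ∫⁻ s, gammaPDF b 1 (s - x) * f (x / s, s) := by
    intro x
    rw [lintegral_withDensity_eq_lintegral_mul _ (by fun_prop) (by fun_prop)]
    rw [← lintegral_sub_right_eq_self _ x]
    simp
  have e2 : ∀ s, ∫⁻ v, f (v, s) ∂volume.withDensity (betaPDF a b) =
      ∫⁻ v, betaPDF a b v * f (v, s) := by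
    intro s
    rw [lintegral_withDensity_eq_lintegral_mul _ (by fun_prop) (by fun_prop)]
    rfl
  simp_rw [e1, e2]
  have e3 : ∀ x, gammaPDF a 1 x * ∫⁻ s, gammaPDF b 1 (s - x) * f (x / s, s) =
      ∫⁻ s, gammaPDF a 1 x * (gammaPDF b 1 (s - x) * f (x / s, s)) := by
    intro x
    rw [lintegral_const_mul _ (by fun_prop)]
  simp_rw [e3]
  rw [lintegral_lintegral_swap (by fun_prop)]
  refine lintegral_congr_ae ?_
  have hne : ∀ᵐ s : ℝ, s ≠ 0 := by simp [ae_iff]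
  filter_upwards [hne] with s hs0
  rcases lt_or_gt_of_ne hs0 with hs | hs
  · rw [gammaPDF_of_neg hs, zero_mul]
    refine (lintegral_congr fun x => ?_).trans lintegral_zero
    rcases lt_or_ge x 0 with hx | hx
    · rw [gammaPDF_of_neg hx, zero_mul]
    · rw [gammaPDF_of_neg (x := s - x) (by linarith), zero_mul, mul_zero]
  · rw [lintegral_scale hs (by fun_prop), ← lintegral_const_mul _ (by fun_prop),
      ← lintegral_const_mul _ (by fun_prop)]
    refine lintegral_congr_ae ?_
    have hne1 : ∀ᵐ s : ℝ, s ≠ 1 := by simp [ae_iff]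
    filter_upwards [hne, hne1] with v hv0 hv1
    rw [mul_div_cancel_left₀ _ hs.ne', ← mul_assoc, ← mul_assoc, ← mul_assoc]
    congr 1
    unfold gammaPDF betaPDF
    have p1 : ∀ x, 0 ≤ gammaPDFReal a 1 x := gammaPDFReal_nonneg ha one_pos
    have p3 : ∀ x, 0 ≤ gammaPDFReal (a + b) 1 x := gammaPDFReal_nonneg (by positivity) one_pos
    rw [mul_assoc, ← ENNReal.ofReal_mul (p1 _), ← ENNReal.ofReal_mul hs.le,
      ← ENNReal.ofReal_mul (p3 _), gammaPDFReal_mul_scaled ha hb hs hv0 hv1, mul_comm]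

end

/-! ### Scale invariant functions of independent gamma variables -/

section

open scoped ENNReal

section PiGamma

variable {ι : Type*} [Fintype ι]

/-- Exponential tilting of a product of gamma laws by the sum of the coordinates amounts to
scaling. -/
lemma pi_gammaMeasure_withDensity_exp {a : ι → ℝ} (ha : ∀ i, 0 < a i) {l : ℝ} (hl : 0 ≤ l) :
    (Measure.pi fun i => gammaMeasure (a i) 1).withDensity
        (fun x => ENNReal.ofReal (Real.exp (-l * ∑ i, x i))) =
      (∏ i, ENNReal.ofReal ((1 / (1 + l)) ^ a i)) •
        (Measure.pi fun i => gammaMeasure (a i) 1).map (fun x i => x i / (1 + l)) := by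
  have hl1 : 0 < 1 + l := by positivity
  have h1 : ∀ i, IsProbabilityMeasure (gammaMeasure (a i) 1) := fun i =>
    isProbabilityMeasure_gammaMeasure (ha i) one_pos
  have h2 : ∀ i, IsProbabilityMeasure (gammaMeasure (a i) (1 + l)) := fun i =>
    isProbabilityMeasure_gammaMeasure (ha i) hl1
  have h3 : ∀ i, IsFiniteMeasure
      (ENNReal.ofReal ((1 / (1 + l)) ^ a i) • gammaMeasure (a i) (1 + l)) := fun i =>
    Measure.smul_finite _ ENNReal.ofReal_ne_top
  have h4 : ∀ i, (gammaMeasure (a i) 1).map (fun x => x / (1 + l)) = gammaMeasure (a i) (1 + l) :=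
    fun i => gammaMeasure_map_div (ha i) hl1
  have h5 : ∀ i, SigmaFinite ((gammaMeasure (a i) 1).map (fun x => x / (1 + l))) := fun i => by
    rw [h4]; infer_instance
  rw [Measure.pi_map_pi (f := fun _ x => x / (1 + l)) (fun i => by fun_prop)]
  simp_rw [h4]
  -- The intermediate measure is the product of the tilted marginals; on boxes the tilt factors over
  -- the coordinates.
  trans Measure.pi fun i => ENNReal.ofReal ((1 / (1 + l)) ^ a i) • gammaMeasure (a i) (1 + l)
  · refine (Measure.pi_eq fun s hs => ?_).symm
    rw [withDensity_apply _ (MeasurableSet.univ_pi hs),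
      ← lintegral_indicator (MeasurableSet.univ_pi hs)]
    have e : ∀ x : ι → ℝ, (Set.univ.pi s).indicator
        (fun x => ENNReal.ofReal (Real.exp (-l * ∑ i, x i))) x =
        ∏ i, (s i).indicator (fun y => ENNReal.ofReal (Real.exp (-l * y))) (x i) := by
      intro x
      by_cases hx : x ∈ Set.univ.pi s
      · rw [Set.indicator_of_mem hx, Finset.mul_sum, Real.exp_sum,
          ENNReal.ofReal_prod_of_nonneg fun i _ => (Real.exp_pos _).le]
        refine Finset.prod_congr rfl fun i _ => ?_
        rw [Set.indicator_of_mem (hx i (Set.mem_univ i))]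
      · rw [Set.indicator_of_notMem hx]
        simp only [Set.mem_pi, Set.mem_univ, true_implies, not_forall] at hx
        obtain ⟨i, hi⟩ := hx
        rw [Finset.prod_eq_zero (Finset.mem_univ i)]
        rw [Set.indicator_of_notMem hi]
    simp_rw [e]
    have hm : ∀ i, Measurable ((s i).indicator fun y => ENNReal.ofReal (Real.exp (-l * y))) :=
      fun i => Measurable.indicator (by fun_prop) (hs i)
    rw [lintegral_prod_eq_prod_lintegral_of_indepFun Finset.univ
      (fun i (x : ι → ℝ) => (s i).indicator (fun y => ENNReal.ofReal (Real.exp (-l * y))) (x i))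
      (iIndepFun_pi fun i => (hm i).aemeasurable) (fun i => (hm i).comp (measurable_pi_apply i))]
    refine Finset.prod_congr rfl fun i _ => ?_
    rw [← gammaMeasure_withDensity_exp (ha i) one_pos hl, withDensity_apply _ (hs i),
      ← lintegral_indicator (hs i)]
    exact (measurePreserving_eval (fun i => gammaMeasure (a i) 1) i).lintegral_comp (hm i)
  · refine Measure.pi_eq fun s hs => ?_
    simp only [Measure.smul_apply, Measure.pi_pi, smul_eq_mul, Finset.prod_mul_distrib]

/-- A scale invariant function of independent gamma variables with the same rate is independent
of their sum. -/
lemma indepFun_sum_pi_gammaMeasure {E : Type*} [MeasurableSpace E] {a : ι → ℝ}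
    (ha : ∀ i, 0 < a i) {q : (ι → ℝ) → E} (hq : Measurable q)
    (hinv : ∀ c : ℝ, 0 < c → ∀ x, q (fun i => x i / c) = q x) :
    IndepFun q (fun x => ∑ i, x i) (Measure.pi fun i => gammaMeasure (a i) 1) := by
  have h1 : ∀ i, IsProbabilityMeasure (gammaMeasure (a i) 1) := fun i =>
    isProbabilityMeasure_gammaMeasure (ha i) one_pos
  set m := Measure.pi fun i => gammaMeasure (a i) 1 with hmdef
  have hpos : ∀ᵐ x ∂m, 0 ≤ ∑ i, x i := by
    have : ∀ᵐ x ∂m, ∀ i, 0 < x i := by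
      rw [ae_all_iff]
      intro i
      exact (measurePreserving_eval (fun i => gammaMeasure (a i) 1) i).quasiMeasurePreserving.ae
        (ae_pos_gammaMeasure (a i) 1)
    filter_upwards [this] with x hx
    exact Finset.sum_nonneg fun i _ => (hx i).le
  -- Tilting becomes scaling by `1 + l`, which preserves `q ⁻¹' S`. The transform of the sum over
  -- this event is thus its mass times a factor independent of `S`.
  have hlap : ∀ S, MeasurableSet S → ∀ l : ℝ, 0 ≤ l →
      ∫ x in q ⁻¹' S, Real.exp (-l * ∑ i, x i) ∂m =
        ((∏ i, ENNReal.ofReal ((1 / (1 + l)) ^ a i)) * m (q ⁻¹' S)).toReal := by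
    intro S hS l hl
    rw [integral_eq_lintegral_of_nonneg_ae (by filter_upwards with x; positivity)
      (Measurable.aestronglyMeasurable (by fun_prop)), ← withDensity_apply _ (hq hS),
      pi_gammaMeasure_withDensity_exp ha hl, Measure.smul_apply, smul_eq_mul,
      Measure.map_apply (by fun_prop) (hq hS)]
    congr 3
    ext x
    simp only [Set.mem_preimage]
    rw [hinv _ (by positivity)]
  rw [indepFun_iff_measure_inter_preimage_eq_mul]
  intro S T hS hT
  have hfin : IsFiniteMeasure (m (q ⁻¹' S) • m.map (fun x => ∑ i, x i)) :=
    Measure.smul_finite _ (measure_ne_top _ _)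
  have key : (m.restrict (q ⁻¹' S)).map (fun x => ∑ i, x i) =
      m (q ⁻¹' S) • m.map (fun x => ∑ i, x i) := by
    have hmeas : MeasurableSet {x : ℝ | 0 ≤ x} := measurableSet_Ici
    refine Measure.ext_of_laplace ?_ ?_ fun l hl => ?_
    · rw [ae_map_iff (by fun_prop) hmeas]
      exact ae_restrict_of_ae hpos
    · refine Measure.ae_smul_measure ?_ _
      rwa [ae_map_iff (by fun_prop) hmeas]
    · rw [integral_map (by fun_prop) (by fun_prop), integral_smul_measure,
        integral_map (by fun_prop) (by fun_prop), hlap S hS l hl]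
      -- The whole space identifies that factor as the Laplace transform of the sum.
      have h := hlap Set.univ MeasurableSet.univ l hl
      simp only [Set.preimage_univ, Measure.restrict_univ, measure_univ, mul_one] at h
      rw [h, ENNReal.toReal_mul, smul_eq_mul, mul_comm]
  have h := congrArg (fun ν => ν T) key
  simp only [Measure.smul_apply, smul_eq_mul] at h
  rw [Measure.map_apply (by fun_prop) hT, Measure.map_apply (by fun_prop) hT,
    Measure.restrict_apply (by exact (Finset.measurable_sum _ fun i _ => by fun_prop) hT)] at h
  rw [Set.inter_comm, h]

end PiGamma

end

/-! ### Tools for independence and finite time grids -/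

section

open scoped ENNReal

section IndependenceTools

variable {Ω : Type*} [MeasurableSpace Ω] {μ : Measure Ω}

lemma IndepFun.of_map {α β δ : Type*} [MeasurableSpace α] [MeasurableSpace β] [MeasurableSpace δ]
    {X : Ω → α} (hX : Measurable X) {f : α → β} {g : α → δ} (hf : Measurable f)
    (hg : Measurable g) (h : IndepFun f g (μ.map X)) :
    IndepFun (fun ω => f (X ω)) (fun ω => g (X ω)) μ := by
  rw [indepFun_iff_measure_inter_preimage_eq_mul] at h ⊢
  intro s t hs ht
  have := h s t hs ht
  rwa [Measure.map_apply hX ((hf hs).inter (hg ht)), Measure.map_apply hX (hf hs),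
    Measure.map_apply hX (hg ht)] at this

/-- The two hypotheses make the joint law a triple product, which is then reassociated. -/
lemma IndepFun.prodMk_right_of_prodMk_left [IsProbabilityMeasure μ] {α β δ : Type*}
    [MeasurableSpace α] [MeasurableSpace β] [MeasurableSpace δ] {A : Ω → α} {B : Ω → β} {C : Ω → δ}
    (hA : Measurable A) (hB : Measurable B) (hC : Measurable C) (hAB : IndepFun A B μ)
    (hABC : IndepFun (fun ω => (A ω, B ω)) C μ) : IndepFun A (fun ω => (B ω, C ω)) μ := by
  have := Measure.isProbabilityMeasure_map hA.aemeasurable (μ := μ)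
  have := Measure.isProbabilityMeasure_map hB.aemeasurable (μ := μ)
  have := Measure.isProbabilityMeasure_map hC.aemeasurable (μ := μ)
  have hBC : IndepFun B C μ := hABC.comp measurable_snd measurable_id
  rw [indepFun_iff_map_prod_eq_prod_map_map (by fun_prop) (by fun_prop)] at hAB hABC hBC ⊢
  rw [hBC, ← Measure.prodAssoc_prod, ← hAB, ← hABC, Measure.map_map (by fun_prop) (by fun_prop)]
  rfl

end IndependenceTools

section Grid

/-- Independent increments are given along ordered times, whereas independence of processes is
tested on finite sets of times. The last clause keeps the grid inside `[0, t]` in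
`indepFun_bridge_eval`. -/
lemma exists_strictMono_grid (F : Finset ℝ≥0) (h0 : 0 ∈ F) :
    ∃ (n : ℕ) (f : Fin (n + 1) → ℝ≥0), StrictMono f ∧ f 0 = 0 ∧ (∀ s ∈ F, ∃ k, f k = s) ∧
      ∀ k, f k ∈ F := by
  obtain ⟨n, hn⟩ : ∃ n, F.card = n + 1 :=
    ⟨F.card - 1, by have := Finset.card_pos.mpr ⟨0, h0⟩; omega⟩
  have hr : ∀ s ∈ F, ∃ k, F.orderEmbOfFin hn k = s := by
    intro s hs
    have := F.range_orderEmbOfFin hn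
    have hs' : s ∈ Set.range (F.orderEmbOfFin hn) := by rw [this]; exact hs
    exact hs'
  refine ⟨n, F.orderEmbOfFin hn, (F.orderEmbOfFin hn).strictMono, ?_, hr,
    fun k => F.orderEmbOfFin_mem hn k⟩
  obtain ⟨k, hk⟩ := hr 0 h0
  refine le_antisymm ?_ zero_le
  rw [← hk]
  exact (F.orderEmbOfFin hn).monotone (Fin.zero_le k)

/-- Telescoping over a filtered index set, so that values at different grid times are partial sums
of one family of increments. -/
lemma sum_increments_le {n : ℕ} (x : Fin (n + 1) → ℝ) (k : Fin (n + 1)) :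
    ∑ i : Fin n with i.succ ≤ k, (x i.succ - x i.castSucc) = x k - x 0 := by
  induction k using Fin.induction with
  | zero => simp
  | succ k ih =>
    have : (Finset.univ.filter fun i : Fin n => i.succ ≤ k.succ) =
        insert k (Finset.univ.filter fun i : Fin n => i.succ ≤ k.castSucc) := by
      ext i
      simp only [Finset.mem_filter, Finset.mem_univ, true_and, Finset.mem_insert, Fin.le_def,
        Fin.ext_iff, Fin.val_succ, Fin.val_castSucc]
      omega
    rw [this, Finset.sum_insert, ih]
    · ring
    · simp [Fin.le_def]

end Grid

/-! ### The gamma process: marginals, strict monotonicity, independence -/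

namespace IsStandardGammaProcess

lemma measurable_path {Ω : Type*} [MeasurableSpace Ω] {μ : Measure Ω} {γ : ℝ≥0 → Ω → ℝ}
    (hγ : IsStandardGammaProcess γ μ) : Measurable fun ω t => γ t ω :=
  measurable_pi_lambda _ hγ.measurable

variable {Ω : Type*} [MeasurableSpace Ω] {μ : Measure Ω} [IsProbabilityMeasure μ]
  {γ : ℝ≥0 → Ω → ℝ}

lemma map_eval (hγ : IsStandardGammaProcess γ μ) {t : ℝ≥0} (ht : 0 < t) :
    μ.map (γ t) = gammaMeasure t 1 := by
  have hm := hγ.measurable t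
  have := isProbabilityMeasure_gammaMeasure (a := (t : ℝ)) (by exact_mod_cast ht) one_pos
  have := Measure.isProbabilityMeasure_map hm.aemeasurable (μ := μ)
  refine Measure.ext_of_laplace ?_ ((ae_pos_gammaMeasure t 1).mono fun x hx => hx.le) fun l hl => ?_
  · rw [ae_map_iff hm.aemeasurable measurableSet_Ici]
    filter_upwards [hγ.zero, hγ.monotone_paths] with ω h0 h1
    rw [← h0]
    exact h1 zero_le
  · rw [integral_map hm.aemeasurable (by fun_prop), hγ.laplace t l hl, integral_gamma_levy hl,
      integral_exp_gammaMeasure (by exact_mod_cast ht) one_pos hl, one_div, Real.inv_rpow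
      (by positivity), ← Real.rpow_neg (by positivity), Real.rpow_def_of_pos (by positivity)]
    congr 1
    ring

lemma map_sub (hγ : IsStandardGammaProcess γ μ) {s t : ℝ≥0} (hst : s < t) :
    μ.map (fun ω => γ t ω - γ s ω) = gammaMeasure ((t : ℝ) - s) 1 := by
  have h := (hγ.stationary_increments s (t - s)).map_eq
  rw [add_tsub_cancel_of_le hst.le, hγ.map_eval (tsub_pos_of_lt hst), NNReal.coe_sub hst.le] at h
  exact h

lemma ae_lt (hγ : IsStandardGammaProcess γ μ) {s t : ℝ≥0} (hst : s < t) :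
    ∀ᵐ ω ∂μ, γ s ω < γ t ω := by
  have hm : Measurable (fun ω => γ t ω - γ s ω) := (hγ.measurable t).sub (hγ.measurable s)
  have h := ae_pos_gammaMeasure ((t : ℝ) - s) 1
  rw [← hγ.map_sub hst, ae_map_iff hm.aemeasurable measurableSet_Ioi] at h
  filter_upwards [h] with ω hω
  linarith

/-- Almost surely strictness holds on a countable dense set; two of its points lie between any `s <
t`, and monotonicity does the rest. -/
lemma ae_strictMono (hγ : IsStandardGammaProcess γ μ) : ∀ᵐ ω ∂μ, StrictMono fun t => γ t ω := by
  obtain ⟨D, hDc, hDd⟩ := TopologicalSpace.exists_countable_dense ℝ≥0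
  have h : ∀ᵐ ω ∂μ, ∀ p ∈ D, ∀ q ∈ D, p < q → γ p ω < γ q ω := by
    rw [ae_ball_iff hDc]
    intro p _
    rw [ae_ball_iff hDc]
    intro q _
    by_cases hpq : p < q
    · filter_upwards [hγ.ae_lt hpq] with ω hω _ using hω
    · exact Filter.Eventually.of_forall fun ω h => absurd h hpq
  filter_upwards [h, hγ.monotone_paths] with ω h1 h2 s t hst
  obtain ⟨p, hp, hsp, hpt⟩ := hDd.exists_between hst
  obtain ⟨q, hq, hpq, hqt⟩ := hDd.exists_between hpt
  exact (h2 hsp.le).trans_lt ((h1 p hp q hq hpq).trans_le (h2 hqt.le))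

/-- On a grid containing `0`, `t` and the finitely many times tested, past values are sums of
increments before `t` (using `γ_0 = 0`) and future ones are sums of increments after `t`. -/
lemma indepFun_past_future (hγ : IsStandardGammaProcess γ μ) (t : ℝ≥0) :
    IndepFun (fun ω (s : Set.Iic t) => γ s ω) (fun ω (h : ℝ≥0) => γ (t + h) ω - γ t ω) μ := by
  classical
  refine IndepFun.process_indepFun_process (fun s => hγ.measurable s)
    (fun h => (hγ.measurable _).sub (hγ.measurable _)) fun I J => ?_
  obtain ⟨n, f, hf, hf0, hfF, -⟩ := exists_strictMono_grid
    (insert 0 (insert t (I.image Subtype.val ∪ J.image (t + ·)))) (by simp)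
  choose! k hk using hfF
  let D : Fin n → Ω → ℝ := fun i ω => γ (f i.succ) ω - γ (f i.castSucc) ω
  have hD : ∀ i, Measurable (D i) := fun i => (hγ.measurable _).sub (hγ.measurable _)
  have hDi : iIndepFun D μ := hγ.indep_increments n f hf.monotone
  let S : Finset (Fin n) := {i | i.succ ≤ k t}
  have hkt : f (k t) = t := hk t (by simp)
  have hST := hDi.indepFun_finset S Sᶜ disjoint_compl_right hD
  have h2 := hST.comp (φ := fun (x : S → ℝ) (s : I) => ∑ i : S, if i.1.succ ≤ k s then x i else 0)
    (ψ := fun (x : (Sᶜ : Finset (Fin n)) → ℝ) (h : J) =>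
      ∑ i : (Sᶜ : Finset (Fin n)), if i.1.succ ≤ k (t + h) then x i else 0)
    (by
      refine measurable_pi_lambda _ fun s => Finset.measurable_sum _ fun i _ => ?_
      split_ifs <;> fun_prop)
    (by
      refine measurable_pi_lambda _ fun s => Finset.measurable_sum _ fun i _ => ?_
      split_ifs <;> fun_prop)
  refine h2.congr ?_ ?_
  · filter_upwards [hγ.zero] with ω h0
    ext s
    have hs : f (k s) = s := hk s (by simp [s.2, show (s : ℝ≥0) ≤ t from s.1.2])
    have hle : k s ≤ k t := by
      rw [← hf.le_iff_le, hs, hkt]; exact s.1.2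
    have hsum := sum_increments_le (fun j => γ (f j) ω) (k s)
    rw [hs, hf0, h0, sub_zero] at hsum
    simp only [Function.comp_apply]
    rw [← hsum, Finset.sum_coe_sort S (fun i => if i.succ ≤ k s then D i ω else 0),
      Finset.sum_ite, Finset.sum_const_zero, add_zero, Finset.filter_filter]
    refine Finset.sum_congr ?_ fun i _ => rfl
    ext i
    simp only [Finset.mem_filter, Finset.mem_univ, true_and]
    exact ⟨fun h => h.2, fun h => ⟨h.trans hle, h⟩⟩
  · refine Filter.Eventually.of_forall fun ω => ?_
    ext h
    have hs : f (k (t + h)) = t + h := hk _ (by simp [h.2])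
    have hle : k t ≤ k (t + h) := by
      rw [← hf.le_iff_le, hs, hkt]; exact le_self_add
    have hsum1 := sum_increments_le (fun j => γ (f j) ω) (k (t + h))
    have hsum2 := sum_increments_le (fun j => γ (f j) ω) (k t)
    rw [hs] at hsum1
    rw [hkt] at hsum2
    simp only [Function.comp_apply]
    have e : γ (t + h) ω - γ t ω =
        (γ (t + h) ω - γ (f 0) ω) - (γ t ω - γ (f 0) ω) := by ring
    rw [e, ← hsum1, ← hsum2, Finset.sum_coe_sort Sᶜ
      (fun i => if i.succ ≤ k (t + h) then D i ω else 0), Finset.sum_ite, Finset.sum_const_zero,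
      add_zero, eq_sub_iff_add_eq, ← Finset.sum_union]
    · refine Finset.sum_congr ?_ fun i _ => rfl
      ext i
      simp only [S, Finset.mem_union, Finset.mem_filter, Finset.mem_univ, true_and,
        Finset.mem_compl]
      constructor
      · rintro (h | h)
        · exact h.2
        · exact h.trans hle
      · intro h
        by_cases h' : i.succ ≤ k t
        · exact Or.inr h'
        · exact Or.inl ⟨h', h⟩
    · rw [Finset.disjoint_left]
      intro i hi hi'
      simp only [S, Finset.mem_filter, Finset.mem_univ, true_and, Finset.mem_compl] at hi hi'
      exact hi.1 hi'

/-- On a grid of `[0, t]` the increments are independent gamma variables of rate one, `γ_t` is their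
sum, and the ratios are scale invariant. -/
lemma indepFun_bridge_eval (hγ : IsStandardGammaProcess γ μ) {t : ℝ≥0} :
    IndepFun (fun ω (s : Set.Iic t) => γ s ω / γ t ω) (γ t) μ := by
  classical
  refine IndepFun.process_indepFun (fun s => (hγ.measurable s).div (hγ.measurable t))
    (hγ.measurable t) fun I => ?_
  obtain ⟨n, f, hf, hf0, hfF, hfmem⟩ := exists_strictMono_grid
    (insert 0 (insert t (I.image Subtype.val))) (by simp)
  choose! k hk using hfF
  have hle : ∀ j, f j ≤ t := by
    intro j
    have := hfmem j
    simp only [Finset.mem_insert, Finset.mem_image] at this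
    rcases this with h | h | ⟨s, _, h⟩
    · rw [h]; exact zero_le
    · exact h.le
    · rw [← h]; exact s.2
  have hkt : f (k t) = t := hk t (by simp)
  have hlast : ∀ j, j ≤ k t := fun j => by rw [← hf.le_iff_le, hkt]; exact hle j
  let D : Fin n → Ω → ℝ := fun i ω => γ (f i.succ) ω - γ (f i.castSucc) ω
  have hD : ∀ i, Measurable (D i) := fun i => (hγ.measurable _).sub (hγ.measurable _)
  have hDi : iIndepFun D μ := hγ.indep_increments n f hf.monotone
  have hDlaw := (iIndepFun_iff_map_fun_eq_pi_map fun i => (hD i).aemeasurable).mp hDi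
  have hlt : ∀ i : Fin n, f i.castSucc < f i.succ := fun i => hf Fin.castSucc_lt_succ
  have hDi' : ∀ i, μ.map (D i) = gammaMeasure ((f i.succ : ℝ) - f i.castSucc) 1 := fun i =>
    hγ.map_sub (hlt i)
  simp_rw [hDi'] at hDlaw
  let q : (Fin n → ℝ) → I → ℝ := fun x s =>
    (∑ i : Fin n with i.succ ≤ k s, x i) / ∑ i, x i
  have hq : Measurable q := by
    refine measurable_pi_lambda _ fun s => Measurable.div ?_ ?_ <;> fun_prop
  have h1 := indepFun_sum_pi_gammaMeasure (fun i => sub_pos.mpr (NNReal.coe_lt_coe.mpr (hlt i))) hq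
    (fun c hc x => by
      ext s
      simp only [q]
      rw [← Finset.sum_div, ← Finset.sum_div, div_div_div_cancel_right₀ hc.ne'])
  rw [← hDlaw] at h1
  have h2 := IndepFun.of_map (measurable_pi_lambda _ hD) hq (by fun_prop) h1
  have hall : ∀ᵐ ω ∂μ, ∑ i, D i ω = γ t ω := by
    filter_upwards [hγ.zero] with ω h0
    have hsum := sum_increments_le (fun j => γ (f j) ω) (k t)
    rw [hkt, hf0, h0, sub_zero] at hsum
    rw [← hsum, Finset.filter_true_of_mem fun i _ => hlast _]
  refine h2.congr ?_ hall
  filter_upwards [hγ.zero, hall] with ω h0 h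
  ext s
  have hs : f (k s) = s := hk s (by simp [s.2, show (s : ℝ≥0) ≤ t from s.1.2])
  have hsum := sum_increments_le (fun j => γ (f j) ω) (k s)
  rw [hs, hf0, h0, sub_zero] at hsum
  simp only [q]
  rw [h, ← hsum]

/-- The rescaled past of the gamma process before `t` is independent of its value at `t`, of its
increments after `t`, and of any variable independent of the process. -/
lemma indepFun_bridge (hγ : IsStandardGammaProcess γ μ) {τ : Ω → ℝ≥0} (hτ : Measurable τ)
    (hindep : IndepFun τ (fun ω t => γ t ω) μ) (t : ℝ≥0) :
    IndepFun (fun ω (s : Set.Iic t) => γ s ω / γ t ω)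
      (fun ω => ((γ t ω, fun h : ℝ≥0 => γ (t + h) ω - γ t ω), τ ω)) μ := by
  have hm := hγ.measurable
  have hB : Measurable fun ω (s : Set.Iic t) => γ s ω / γ t ω :=
    measurable_pi_lambda _ fun s => (hm s).div (hm t)
  have hV : Measurable fun ω (h : ℝ≥0) => γ (t + h) ω - γ t ω :=
    measurable_pi_lambda _ fun h => (hm _).sub (hm t)
  -- Independent pieces are added one at a time: `γ_t`, then the later increments, then `τ`.
  refine IndepFun.prodMk_right_of_prodMk_left hB ((hm t).prodMk hV) hτ ?_ ?_
  · refine IndepFun.prodMk_right_of_prodMk_left hB (hm t) hV hγ.indepFun_bridge_eval ?_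
    exact (hγ.indepFun_past_future t).comp
      (φ := fun x : Set.Iic t → ℝ => 
        (fun s => x s / x ⟨t, Set.mem_Iic.mpr le_rfl⟩, x ⟨t, Set.mem_Iic.mpr le_rfl⟩))
      (by
        refine Measurable.prodMk (measurable_pi_lambda _ fun s => ?_) (measurable_pi_apply _)
        exact Measurable.div (f := fun x : Set.Iic t → ℝ => x s)
          (g := fun x : Set.Iic t → ℝ => x ⟨t, Set.mem_Iic.mpr le_rfl⟩)
          (measurable_pi_apply _) (measurable_pi_apply _)) measurable_id
  · exact hindep.symm.comp
      (φ := fun x : ℝ≥0 → ℝ => ((fun s : Set.Iic t => x s / x t), x t, fun h => x (t + h) - x t))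
      (by fun_prop) measurable_id

end IsStandardGammaProcess

end

/-! ### Evaluation of paths at random times; the bridge and its filtration -/

section

open Filter Topology

section PathEvaluation

/-- A sequence decreasing to `r` strictly from the right, with countable range at each rank. -/
noncomputable def rightApprox (n : ℕ) (r : ℝ≥0) : ℝ≥0 := (⌊r * (n + 1)⌋₊ + 1) / (n + 1)

/-- Evaluation of right continuous paths, jointly measurable in the path and in time. -/
noncomputable def pathEval (p : ℝ≥0 → ℝ) (r : ℝ≥0) : ℝ :=
  limsup (fun n => p (rightApprox n r)) atTop

/-- At each rank the approximating time depends on `r` only through an integer, so evaluation there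
splits into countably many coordinate maps. Plain evaluation at a varying time need not be
measurable for the product σ-algebra. -/
lemma measurable_pathEval : Measurable fun q : (ℝ≥0 → ℝ) × ℝ≥0 => pathEval q.1 q.2 := by
  refine Measurable.limsup fun n => ?_
  have h1 : Measurable fun q : (ℝ≥0 → ℝ) × ℕ => q.1 (((q.2 : ℝ≥0) + 1) / (n + 1)) :=
    measurable_from_prod_countable_left fun k =>
      measurable_pi_apply (X := fun _ : ℝ≥0 => ℝ) (((k : ℝ≥0) + 1) / (n + 1))
  have h2 : Measurable fun q : (ℝ≥0 → ℝ) × ℝ≥0 => (q.1, ⌊q.2 * (n + 1)⌋₊) :=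
    measurable_fst.prodMk (Nat.measurable_floor.comp (by fun_prop))
  exact h1.comp h2

lemma lt_rightApprox (n : ℕ) (r : ℝ≥0) : r < rightApprox n r := by
  unfold rightApprox
  rw [lt_div_iff₀ (by positivity)]
  exact Nat.lt_floor_add_one _

lemma tendsto_rightApprox (r : ℝ≥0) :
    Tendsto (fun n => rightApprox n r) atTop (𝓝[≥] r) := by
  refine tendsto_nhdsWithin_iff.mpr ⟨?_, Eventually.of_forall fun n => (lt_rightApprox n r).le⟩
  have hle : ∀ n : ℕ, rightApprox n r ≤ r + 1 / ((n : ℝ≥0) + 1) := by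
    intro n
    unfold rightApprox
    rw [div_le_iff₀ (by positivity), add_mul, div_mul_cancel₀ _ (by positivity)]
    gcongr
    exact Nat.floor_le zero_le
  refine tendsto_of_tendsto_of_tendsto_of_le_of_le tendsto_const_nhds (h := fun n : ℕ =>
    r + 1 / ((n : ℝ≥0) + 1)) ?_ (fun n => (lt_rightApprox n r).le) hle
  have : Tendsto (fun n : ℕ => 1 / ((n : ℝ≥0) + 1)) atTop (𝓝 0) :=
    tendsto_one_div_add_atTop_nhds_zero_nat
  simpa using tendsto_const_nhds.add this

lemma pathEval_eq {p : ℝ≥0 → ℝ} {r : ℝ≥0} (hp : ContinuousWithinAt p (Set.Ici r) r) :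
    pathEval p r = p r :=
  (hp.tendsto.comp (tendsto_rightApprox r)).limsup_eq

attribute [irreducible] pathEval

lemma Measurable.pathEval_comp {Ω : Type*} [MeasurableSpace Ω] {f : Ω → ℝ≥0 → ℝ} {r : Ω → ℝ≥0}
    (hf : Measurable f) (hr : Measurable r) : Measurable fun ω => pathEval (f ω) (r ω) := by
  have h : Measurable fun ω => (f ω, r ω) := hf.prodMk hr
  exact measurable_pathEval.comp h

end PathEvaluation

/-- Paths with the regularity properties that almost all gamma paths have. -/
structure IsGammaPath (p : ℝ≥0 → ℝ) : Prop where
  zero : p 0 = 0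
  strictMono : StrictMono p
  rightCont : ∀ t, ContinuousWithinAt p (Set.Ici t) t

namespace IsGammaPath

variable {p : ℝ≥0 → ℝ}

lemma pos (hp : IsGammaPath p) {r : ℝ≥0} (hr : 0 < r) : 0 < p r := by
  rw [← hp.zero]; exact hp.strictMono hr

lemma pathEval_apply (hp : IsGammaPath p) (r : ℝ≥0) : pathEval p r = p r := pathEval_eq (hp.rightCont r)

/-- Recovers the path after `t` from its increments, the form in which it is independent of the
rescaled past. -/
lemma pathEval_shift (hp : IsGammaPath p) {t r : ℝ≥0} (h : t ≤ r) :
    pathEval (fun h => p (t + h) - p t) (r - t) = p r - p t := by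
  rw [pathEval_eq, add_tsub_cancel_of_le h]
  have h1 : ContinuousWithinAt p (Set.Ici (t + (r - t))) (t + (r - t)) := hp.rightCont _
  refine ContinuousWithinAt.sub ?_ continuousWithinAt_const
  exact h1.comp (f := fun h => t + h) (by fun_prop) fun x hx => by
    simp only [Set.mem_Ici] at hx ⊢
    gcongr

lemma bridge_mem_Ioo (hp : IsGammaPath p) {t r : ℝ≥0} (ht : 0 < t) (h : t < r) :
    p t / p r ∈ Set.Ioo (0 : ℝ) 1 :=
  ⟨div_pos (hp.pos ht) (hp.pos (ht.trans h)),
    (div_lt_one (hp.pos (ht.trans h))).mpr (hp.strictMono h)⟩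

end IsGammaPath

section

variable {Ω : Type*} {γ : ℝ≥0 → Ω → ℝ}

lemma randomGammaBridge_of_le {τ : Ω → ℝ≥0} {ω : Ω} (hp : IsGammaPath fun t => γ t ω)
    (hτ : 0 < τ ω) {s : ℝ≥0} (hs : τ ω ≤ s) : randomGammaBridge γ τ s ω = 1 := by
  rw [randomGammaBridge, gammaBridge, min_eq_right hs, div_self (hp.pos hτ).ne']

lemma randomGammaBridge_of_lt {τ : Ω → ℝ≥0} {ω : Ω} {s : ℝ≥0} (hs : s < τ ω) :
    randomGammaBridge γ τ s ω = γ s ω / γ (τ ω) ω := by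
  rw [randomGammaBridge, gammaBridge, min_eq_left hs.le]

lemma randomGammaBridge_lt_one {τ : Ω → ℝ≥0} {ω : Ω} (hp : IsGammaPath fun t => γ t ω)
    {s : ℝ≥0} (hs : s < τ ω) : randomGammaBridge γ τ s ω < 1 := by
  rw [randomGammaBridge_of_lt hs, div_lt_one (hp.pos (zero_le.trans_lt hs))]
  exact hp.strictMono hs

/-- By strict monotonicity the bridge reaches `1` at `τ` and not before, so observing it reveals
whether `τ` has occurred. -/
lemma randomGammaBridge_eq_one_iff {τ : Ω → ℝ≥0} {ω : Ω} (hp : IsGammaPath fun t => γ t ω)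
    (hτ : 0 < τ ω) {s : ℝ≥0} : randomGammaBridge γ τ s ω = 1 ↔ τ ω ≤ s := by
  refine ⟨fun h => ?_, randomGammaBridge_of_le hp hτ⟩
  by_contra hs
  exact (randomGammaBridge_lt_one hp (not_le.mp hs)).ne h

lemma randomGammaBridge_mem_Ioo_iff {τ : Ω → ℝ≥0} {ω : Ω} (hp : IsGammaPath fun t => γ t ω)
    (hτ : 0 < τ ω) {s : ℝ≥0} (hs0 : 0 < s) :
    randomGammaBridge γ τ s ω ∈ Set.Ioo 0 1 ↔ s < τ ω := by
  constructor
  · intro h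
    by_contra hs
    exact h.2.ne (randomGammaBridge_of_le hp hτ (not_lt.mp hs))
  · intro h
    rw [randomGammaBridge_of_lt h]
    exact hp.bridge_mem_Ioo hs0 h

end

section

variable {Ω : Type*} [MeasurableSpace Ω] {μ : Measure Ω} {γ : ℝ≥0 → Ω → ℝ}

lemma IsStandardGammaProcess.ae_isGammaPath [IsProbabilityMeasure μ]
    (hγ : IsStandardGammaProcess γ μ) : ∀ᵐ ω ∂μ, IsGammaPath fun t => γ t ω := by
  filter_upwards [hγ.zero, hγ.ae_strictMono, hγ.rightContinuous_paths] with ω h1 h2 h3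
  exact ⟨h1, h2, h3⟩

/-- The version built with `pathEval` is measurable and agrees almost surely with the bridge;
completeness of `μ` transfers measurability. -/
lemma measurable_randomGammaBridge [IsProbabilityMeasure μ] [μ.IsComplete]
    (hγ : IsStandardGammaProcess γ μ) {τ : Ω → ℝ≥0} (hτ : Measurable τ) (s : ℝ≥0) :
    Measurable (randomGammaBridge γ τ s) := by
  have hm := hγ.measurable_path
  have h : Measurable fun ω =>
      pathEval (fun t => γ t ω) (min s (τ ω)) / pathEval (fun t => γ t ω) (τ ω) :=
    (hm.pathEval_comp (measurable_const.min hτ)).div (hm.pathEval_comp hτ)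
  refine h.congr_ae (μ := μ) ?_
  filter_upwards [hγ.ae_isGammaPath] with ω hp
  rw [hp.pathEval_apply, hp.pathEval_apply]
  rfl

lemma completedNatural_le [μ.IsComplete] {Y : ℝ≥0 → Ω → ℝ} (hY : ∀ s, Measurable (Y s))
    (t : ℝ≥0) : completedNatural Y μ t ≤ ‹MeasurableSpace Ω› := by
  refine sup_le (iSup₂_le fun s _ => (hY s).comap_le) ?_
  refine MeasurableSpace.generateFrom_le fun N hN => ?_
  exact Measure.IsComplete.out' N hN

lemma measurable_completedNatural {Y : ℝ≥0 → Ω → ℝ} {s t : ℝ≥0} (hs : s ≤ t) :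
    Measurable[completedNatural Y μ t] (Y s) :=
  (comap_measurable (Y s)).mono ((le_iSup₂ (f := fun s (_ : s ≤ t) =>
    MeasurableSpace.comap (Y s) inferInstance) s hs).trans le_sup_left) le_rfl

/-- A set of the completed natural filtration is almost surely equal to a set described by the
past of the process. -/
lemma exists_measurableSet_of_completedNatural {Y : ℝ≥0 → Ω → ℝ} {t : ℝ≥0} {A : Set Ω}
    (hA : MeasurableSet[completedNatural Y μ t] A) :
    ∃ S : Set (Set.Iic t → ℝ), MeasurableSet S ∧
      A =ᵐ[μ] {ω | (fun s : Set.Iic t => Y s ω) ∈ S} := by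
  -- Sets almost surely equal to a past event form a σ-algebra; it contains the past itself and,
  -- through `∅`, every null set.
  have hle : completedNatural Y μ t ≤ eventuallyMeasurableSpace
      (MeasurableSpace.comap (fun ω (s : Set.Iic t) => Y s ω) inferInstance) (ae μ) := by
    refine sup_le (iSup₂_le fun s hs => ?_) ?_
    · refine le_trans ?_ le_eventuallyMeasurableSpace
      have : Y s = (fun x : Set.Iic t → ℝ => x ⟨s, hs⟩) ∘ fun ω (s : Set.Iic t) => Y s ω := rfl
      rw [this, ← MeasurableSpace.comap_comp]
      exact MeasurableSpace.comap_mono (measurable_pi_apply _).comap_le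
    · refine MeasurableSpace.generateFrom_le fun N hN => ?_
      exact ⟨∅, @MeasurableSet.empty _ (_), ae_eq_empty.mpr hN⟩
  obtain ⟨B, ⟨S, hS, rfl⟩, hAB⟩ := hle A hA
  exact ⟨S, hS, hAB⟩

lemma measurableSet_completedNatural_of_ae_eq {Y : ℝ≥0 → Ω → ℝ} {t : ℝ≥0} {A B : Set Ω}
    (hB : MeasurableSet[completedNatural Y μ t] B) (h : A =ᵐ[μ] B) :
    MeasurableSet[completedNatural Y μ t] A := by
  have hnull : ∀ N : Set Ω, μ N = 0 → MeasurableSet[completedNatural Y μ t] N := fun N hN =>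
    (le_sup_right : _ ≤ completedNatural Y μ t) N (MeasurableSpace.measurableSet_generateFrom hN)
  have h1 := hnull _ (ae_eq_set.mp h).1
  have h2 := hnull _ (ae_eq_set.mp h).2
  have : A = (B \ (B \ A)) ∪ (A \ B) := by
    ext x; simp only [Set.mem_union, Set.mem_sdiff]; tauto
  rw [this]
  exact (hB.diff h2).union h1

end

end

/-! ### Beta laws and the laws of bridges of fixed length -/

section

open scoped ENNReal

section BetaLaw

/-- The function is continuous off its poles, which are countable. Joint measurability of the bridge
density in the length `r` depends on this. -/
lemma measurable_realGamma : Measurable Real.Gamma := by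
  set P : Set ℝ := Set.range fun n : ℕ => -(n : ℝ) with hP
  have hc : P.Countable := Set.countable_range _
  refine measurable_of_restrict_of_restrict_compl hc.measurableSet ?_ ?_
  · have : Countable P := hc.to_subtype
    exact measurable_of_countable _
  · refine ContinuousOn.domRestrict (fun x hx => ?_) |>.measurable
    refine (Real.differentiableAt_Gamma fun n hn => hx ?_).continuousAt.continuousWithinAt
    exact ⟨n, hn.symm⟩

lemma Measurable.betaPDFReal_comp {Ω : Type*} [MeasurableSpace Ω] {a b x : Ω → ℝ}
    (ha : Measurable a) (hb : Measurable b) (hx : Measurable x) :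
    Measurable fun ω => betaPDFReal (a ω) (b ω) (x ω) := by
  unfold betaPDFReal beta
  have h1 := measurable_realGamma.comp ha
  have h2 := measurable_realGamma.comp hb
  have h3 := measurable_realGamma.comp (ha.add hb)
  simp only [Function.comp_def, Pi.add_apply] at h1 h2 h3
  refine Measurable.ite ?_ ?_ measurable_const
  · exact (measurableSet_lt measurable_const hx).inter (measurableSet_lt hx measurable_const)
  · exact ((measurable_const.div ((h1.mul h2).div h3)).mul (hx.pow (ha.sub_const 1))).mul
      ((measurable_const.sub hx).pow (hb.sub_const 1))

lemma measurable_bridgeDensity (t : ℝ≥0) :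
    Measurable fun p : ℝ≥0 × ℝ => bridgeDensity t p.1 p.2 :=
  Measurable.betaPDFReal_comp measurable_const (by fun_prop) (by fun_prop)

lemma betaPDFReal_nonneg {a b : ℝ} (ha : 0 < a) (hb : 0 < b) (x : ℝ) : 0 ≤ betaPDFReal a b x := by
  by_cases h : 0 < x ∧ x < 1
  · exact (betaPDFReal_pos h.1 h.2 ha hb).le
  · rw [betaPDFReal, if_neg h]

lemma integrable_betaPDFReal {a b : ℝ} (ha : 0 < a) (hb : 0 < b) :
    Integrable (betaPDFReal a b) := by
  refine ⟨(measurable_betaPDFReal a b).aestronglyMeasurable, ?_⟩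
  rw [hasFiniteIntegral_iff_ofReal (Filter.Eventually.of_forall (betaPDFReal_nonneg ha hb))]
  have := lintegral_betaPDF_eq_one ha hb
  simp only [betaPDF] at this
  rw [this]
  exact ENNReal.one_lt_top

lemma integral_betaPDFReal {a b : ℝ} (ha : 0 < a) (hb : 0 < b) :
    ∫ x, betaPDFReal a b x = 1 := by
  have := lintegral_betaPDF_eq_one ha hb
  simp only [betaPDF] at this
  rw [integral_eq_lintegral_of_nonneg_ae (Filter.Eventually.of_forall (betaPDFReal_nonneg ha hb))
    (measurable_betaPDFReal a b).aestronglyMeasurable, this, ENNReal.toReal_one]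

lemma setIntegral_betaMeasure {a b : ℝ} (ha : 0 < a) (hb : 0 < b) (f : ℝ → ℝ) {C : Set ℝ}
    (hC : MeasurableSet C) :
    ∫ x in C, f x ∂betaMeasure a b = ∫ x in C, betaPDFReal a b x * f x := by
  rw [betaMeasure, setIntegral_withDensity_eq_setIntegral_toReal_smul (by fun_prop)
    (Filter.Eventually.of_forall fun x => by simp [betaPDF]) _ hC]
  refine integral_congr_ae (Filter.Eventually.of_forall fun x => ?_)
  simp only [betaPDF, smul_eq_mul]
  rw [ENNReal.toReal_ofReal (betaPDFReal_nonneg ha hb x)]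

lemma integral_betaMeasure {a b : ℝ} (ha : 0 < a) (hb : 0 < b) (f : ℝ → ℝ) :
    ∫ x, f x ∂betaMeasure a b = ∫ x, betaPDFReal a b x * f x := by
  have := setIntegral_betaMeasure ha hb f MeasurableSet.univ
  simpa using this

/-- Substitution `y = x + (1 - x) b`, with Jacobian `1 - x`; the powers of `1 - x` cancel since
`(u-t-1) + (r-u-1) + 1 = r-t-1`. -/
lemma bridgeTransition_scaled {t u r x b : ℝ} (hx : x < 1) :
    (1 - x) * (Set.Ioo x 1).indicator
      (fun y => Real.Gamma (r - t) / (Real.Gamma (u - t) * Real.Gamma (r - u)) *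
        ((y - x) ^ (u - t - 1) * (1 - y) ^ (r - u - 1) / (1 - x) ^ (r - t - 1)))
          ((1 - x) * b + x) = betaPDFReal (u - t) (r - u) b := by
  have hs : 0 < 1 - x := by linarith
  unfold betaPDFReal
  by_cases h : 0 < b ∧ b < 1
  · have h1 : 0 < 1 - b := by linarith [h.2]
    rw [if_pos h, Set.indicator_of_mem
      (show (1 - x) * b + x ∈ Set.Ioo x 1 from ⟨by nlinarith [h.1], by nlinarith [h.2]⟩)]
    have e1 : (1 - x) * b + x - x = (1 - x) * b := by ring
    have e2 : 1 - ((1 - x) * b + x) = (1 - x) * (1 - b) := by ring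
    rw [e1, e2, Real.mul_rpow hs.le h.1.le, Real.mul_rpow hs.le h1.le]
    have e3 : (1 - x) ^ (r - t - 1) =
        (1 - x) * ((1 - x) ^ (u - t - 1) * (1 - x) ^ (r - u - 1)) := by
      nth_rewrite 2 [← Real.rpow_one (1 - x)]
      rw [← Real.rpow_add hs, ← Real.rpow_add hs]
      ring_nf
    have e4 : u - t + (r - u) = r - t := by ring
    rw [e3, beta, e4]
    have p1 := (Real.rpow_pos_of_pos hs (u - t - 1)).ne'
    have p2 := (Real.rpow_pos_of_pos hs (r - u - 1)).ne'
    rw [one_div_div]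
    field_simp
  · rw [if_neg h, Set.indicator_of_notMem, mul_zero]
    rintro ⟨h1, h2⟩
    exact h ⟨by nlinarith, by nlinarith⟩

/-- The transition law of the gamma bridge is a rescaled beta law. -/
lemma bridgeTransition_eq_map {t u r x : ℝ} (hx : x < 1) :
    bridgeTransition t u r x =
      (betaMeasure (u - t) (r - u)).map fun b => (1 - x) * b + x := by
  have hs : 0 < 1 - x := by linarith
  have hind : Measurable ((Set.Ioo x 1).indicator
      (fun y => Real.Gamma (r - t) / (Real.Gamma (u - t) * Real.Gamma (r - u)) *
        ((y - x) ^ (u - t - 1) * (1 - y) ^ (r - u - 1) / (1 - x) ^ (r - t - 1)))) :=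
    Measurable.indicator (by fun_prop) measurableSet_Ioo
  refine Measure.ext_of_lintegral _ fun f hf => ?_
  rw [lintegral_map hf (by fun_prop), bridgeTransition, betaMeasure,
    lintegral_withDensity_eq_lintegral_mul _ (by fun_prop) hf,
    lintegral_withDensity_eq_lintegral_mul _ (by fun_prop) (by fun_prop),
    ← lintegral_add_right_eq_self _ x, lintegral_scale hs, ← lintegral_const_mul]
  · refine lintegral_congr fun b => ?_
    simp only [Pi.mul_apply]
    rw [← mul_assoc, ← ENNReal.ofReal_mul hs.le, bridgeTransition_scaled hx]
    rfl
  · simp only [Pi.mul_apply]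
    fun_prop
  · simp only [Pi.mul_apply]
    fun_prop

end BetaLaw

namespace IsStandardGammaProcess

variable {Ω : Type*} [MeasurableSpace Ω] {μ : Measure Ω} [IsProbabilityMeasure μ]
  {γ : ℝ≥0 → Ω → ℝ}

lemma map_ratio_of_indepFun {X W : Ω → ℝ} {a b : ℝ} (ha : 0 < a) (hb : 0 < b) (hX : Measurable X)
    (hW : Measurable W) (hXa : μ.map X = gammaMeasure a 1) (hWb : μ.map W = gammaMeasure b 1)
    (h : IndepFun X W μ) :
    μ.map (fun ω => X ω / (X ω + W ω)) = betaMeasure a b ∧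
      μ.map (fun ω => X ω + W ω) = gammaMeasure (a + b) 1 ∧
      IndepFun (fun ω => X ω / (X ω + W ω)) (fun ω => X ω + W ω) μ := by
  have := isProbabilityMeasure_gammaMeasure ha one_pos
  have := isProbabilityMeasure_gammaMeasure hb one_pos
  have := isProbabilityMeasure_gammaMeasure (add_pos ha hb) one_pos
  have := isProbabilityMeasureBeta ha hb
  have hm : Measurable fun ω => X ω / (X ω + W ω) := hX.div (hX.add hW)
  have hs : Measurable fun ω => X ω + W ω := hX.add hW
  have hj : μ.map (fun ω => (X ω / (X ω + W ω), X ω + W ω)) =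
      (betaMeasure a b).prod (gammaMeasure (a + b) 1) := by
    rw [← map_gamma_prod_gamma ha hb, ← hXa, ← hWb,
      ← (indepFun_iff_map_prod_eq_prod_map_map hX.aemeasurable hW.aemeasurable).mp h,
      Measure.map_map (by fun_prop) (hX.prodMk hW)]
    rfl
  have h1 : μ.map (fun ω => X ω / (X ω + W ω)) = betaMeasure a b := by
    have := congrArg (Measure.map Prod.fst) hj
    rw [Measure.map_map measurable_fst (hm.prodMk hs), Measure.map_fst_prod] at this
    simpa [Function.comp_def] using this
  have h2 : μ.map (fun ω => X ω + W ω) = gammaMeasure (a + b) 1 := by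
    have := congrArg (Measure.map Prod.snd) hj
    rw [Measure.map_map measurable_snd (hm.prodMk hs), Measure.map_snd_prod] at this
    simpa [Function.comp_def] using this
  refine ⟨h1, h2, ?_⟩
  rw [indepFun_iff_map_prod_eq_prod_map_map hm.aemeasurable hs.aemeasurable, h1, h2, hj]

lemma indepFun_eval_future (hγ : IsStandardGammaProcess γ μ) (t : ℝ≥0) :
    IndepFun (γ t) (fun ω (h : ℝ≥0) => γ (t + h) ω - γ t ω) μ :=
  (hγ.indepFun_past_future t).comp (φ := fun x : Set.Iic t → ℝ => x ⟨t, Set.mem_Iic.mpr le_rfl⟩)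
    (measurable_pi_apply _) measurable_id

lemma map_bridge (hγ : IsStandardGammaProcess γ μ) {t r : ℝ≥0} (ht : 0 < t) (htr : t < r) :
    μ.map (fun ω => γ t ω / γ r ω) = betaMeasure t ((r : ℝ) - t) := by
  have hi : IndepFun (γ t) (fun ω => γ r ω - γ t ω) μ := by
    have := (hγ.indepFun_eval_future t).comp measurable_id
      (measurable_pi_apply (X := fun _ : ℝ≥0 => ℝ) (r - t))
    simpa [Function.comp_def, add_tsub_cancel_of_le htr.le] using this
  have h := (map_ratio_of_indepFun (NNReal.coe_pos.mpr ht)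
    (sub_pos.mpr (NNReal.coe_lt_coe.mpr htr)) (hγ.measurable t)
    ((hγ.measurable r).sub (hγ.measurable t)) (hγ.map_eval ht) (hγ.map_sub htr) hi).1
  simpa using h

/-- Given its value at time `t`, the gamma bridge of length `r` at time `u` is obtained with an
independent beta variable. -/
lemma bridge_increment (hγ : IsStandardGammaProcess γ μ) {t u r : ℝ≥0} (htu : t < u)
    (hur : u < r) :
    μ.map (fun ω => (γ u ω - γ t ω) / (γ r ω - γ t ω)) = betaMeasure ((u : ℝ) - t) ((r : ℝ) - u) ∧
      IndepFun (fun ω => γ t ω / γ r ω) (fun ω => (γ u ω - γ t ω) / (γ r ω - γ t ω)) μ := by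
  have hm := hγ.measurable
  have hY : Measurable fun ω => γ u ω - γ t ω := (hm u).sub (hm t)
  have hW : Measurable fun ω => γ r ω - γ u ω := (hm r).sub (hm u)
  have hS : Measurable fun ω => γ r ω - γ t ω := (hm r).sub (hm t)
  have hi : IndepFun (fun ω => γ u ω - γ t ω) (fun ω => γ r ω - γ u ω) μ :=
    hγ.indep_increments.indepFun_sub_sub htu.le hur.le
  obtain ⟨h1, -, h3⟩ := map_ratio_of_indepFun (sub_pos.mpr (NNReal.coe_lt_coe.mpr htu))
    (sub_pos.mpr (NNReal.coe_lt_coe.mpr hur)) hY hW (hγ.map_sub htu) (hγ.map_sub hur) hi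
  have e : ∀ ω, γ u ω - γ t ω + (γ r ω - γ u ω) = γ r ω - γ t ω := fun ω => by ring
  simp_rw [e] at h1 h3
  refine ⟨h1, ?_⟩
  -- The ratio is independent of `S = γ_r - γ_t`, and both are independent of `γ_t`; hence it is
  -- independent of `(S, γ_t)` and of `γ_t / (γ_t + S)`.
  have hX : IndepFun (fun ω => ((γ u ω - γ t ω) / (γ r ω - γ t ω), γ r ω - γ t ω)) (γ t) μ := by
    have := (hγ.indepFun_eval_future t).symm.comp (φ := fun v : ℝ≥0 → ℝ =>
      (v (u - t) / v (r - t), v (r - t))) (by fun_prop) measurable_id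
    simpa [Function.comp_def, add_tsub_cancel_of_le htu.le,
      add_tsub_cancel_of_le (htu.trans hur).le] using this
  have h4 := IndepFun.prodMk_right_of_prodMk_left (hY.div hS) hS (hm t) h3 hX
  have h5 := h4.symm.comp (φ := fun p : ℝ × ℝ => p.2 / (p.2 + p.1)) (by fun_prop) measurable_id
  simp only [Function.comp_def, add_sub_cancel] at h5
  exact h5

end IsStandardGammaProcess

end

/-! ### Bayes' formula for the unknown length -/

section Bayes

variable {P : Measure ℝ≥0} {t : ℝ≥0} {G : ℝ≥0 → ℝ → ℝ} {M : ℝ}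

/-- The Bayes estimate of `G r x`, where `r` is the unknown length of the bridge and `x` its
observed value at time `t`. -/
noncomputable def bayesMean (P : Measure ℝ≥0) (t : ℝ≥0) (G : ℝ≥0 → ℝ → ℝ) (x : ℝ) : ℝ :=
  ∫ r in Set.Ioi t, G r x * bayesWeight P t r x ∂P

lemma bridgeDensity_nonneg (ht : 0 < t) {r : ℝ≥0} (hr : t < r) (x : ℝ) :
    0 ≤ bridgeDensity t r x :=
  betaPDFReal_nonneg (NNReal.coe_pos.mpr ht) (sub_pos.mpr (NNReal.coe_lt_coe.mpr hr)) x

lemma bayesMean_eq_div (x : ℝ) : bayesMean P t G x =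
    (∫ r in Set.Ioi t, G r x * bridgeDensity t r x ∂P) /
      ∫ s in Set.Ioi t, bridgeDensity t s x ∂P := by
  rw [bayesMean, ← integral_div]
  simp only [bayesWeight, mul_div_assoc]

lemma integrableOn_mul_bridgeDensity (hG : Measurable fun p : ℝ≥0 × ℝ => G p.1 p.2)
    (hM : ∀ r x, |G r x| ≤ M) {x : ℝ}
    (hx : IntegrableOn (fun r : ℝ≥0 => bridgeDensity t r x) (Set.Ioi t) P) :
    IntegrableOn (fun r => G r x * bridgeDensity t r x) (Set.Ioi t) P :=
  hx.bdd_mul (c := M) (hG.comp (measurable_id.prodMk measurable_const)).aestronglyMeasurable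
    (Filter.Eventually.of_forall fun r => hM r x)

lemma setIntegral_bridgeDensity_nonneg (ht : 0 < t) (x : ℝ) :
    0 ≤ ∫ s in Set.Ioi t, bridgeDensity t s x ∂P :=
  setIntegral_nonneg measurableSet_Ioi fun _ hr => bridgeDensity_nonneg ht hr x

/-- The weights are nonnegative of total mass `1` or `0`. If the density is not integrable in `r`,
the normalising integral is `0` by convention and so is the mean. -/
lemma abs_bayesMean_le (ht : 0 < t) (hM0 : 0 ≤ M) (hM : ∀ r x, |G r x| ≤ M) (x : ℝ) :
    |bayesMean P t G x| ≤ M := by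
  rw [bayesMean_eq_div, abs_div, abs_of_nonneg (setIntegral_bridgeDensity_nonneg ht x)]
  by_cases hx : IntegrableOn (fun r : ℝ≥0 => bridgeDensity t r x) (Set.Ioi t) P
  · refine div_le_of_le_mul₀ (setIntegral_bridgeDensity_nonneg ht x) hM0 ?_
    rw [← integral_const_mul, ← Real.norm_eq_abs]
    refine norm_integral_le_of_norm_le (hx.const_mul M) ?_
    filter_upwards [ae_restrict_mem measurableSet_Ioi] with r hr
    rw [norm_mul, Real.norm_of_nonneg (bridgeDensity_nonneg ht hr x)]
    exact mul_le_mul_of_nonneg_right (hM r x) (bridgeDensity_nonneg ht hr x)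
  · rw [integral_undef (f := fun r : ℝ≥0 => bridgeDensity t r x) hx, div_zero]
    exact hM0

/-- A weighted average centres its integrand. If the normaliser is `0`, the nonnegative density
vanishes almost everywhere and so does the numerator. -/
lemma setIntegral_bridgeDensity_mul_sub_bayesMean (ht : 0 < t)
    (hG : Measurable fun p : ℝ≥0 × ℝ => G p.1 p.2) (hM : ∀ r x, |G r x| ≤ M) {x : ℝ}
    (hx : IntegrableOn (fun r : ℝ≥0 => bridgeDensity t r x) (Set.Ioi t) P) :
    ∫ r in Set.Ioi t, bridgeDensity t r x * (G r x - bayesMean P t G x) ∂P = 0 := by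
  simp_rw [mul_sub, mul_comm (bridgeDensity _ _ _)]
  rw [integral_sub (integrableOn_mul_bridgeDensity hG hM hx) (hx.const_mul _), integral_const_mul,
    bayesMean_eq_div]
  by_cases h0 : ∫ s in Set.Ioi t, bridgeDensity t s x ∂P = 0
  · rw [h0, mul_zero, sub_zero]
    rw [integral_eq_zero_iff_of_nonneg_ae _ hx] at h0
    · refine integral_eq_zero_of_ae ?_
      filter_upwards [h0] with r hr
      rw [hr]; simp
    · filter_upwards [ae_restrict_mem measurableSet_Ioi] with r hr
      exact bridgeDensity_nonneg ht hr x
  · rw [div_mul_cancel₀ _ h0, sub_self]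

variable [IsFiniteMeasure P]

lemma measurable_bayesWeight : Measurable fun p : ℝ≥0 × ℝ => bayesWeight P t p.1 p.2 := by
  have h := measurable_bridgeDensity t
  have h2 : StronglyMeasurable fun x : ℝ => ∫ s in Set.Ioi t, bridgeDensity t s x ∂P :=
    StronglyMeasurable.integral_prod_left (f := fun s x => bridgeDensity t s x)
      (μ := P.restrict (Set.Ioi t)) h.stronglyMeasurable
  exact h.div (h2.measurable.comp measurable_snd)

lemma measurable_bayesMean (hG : Measurable fun p : ℝ≥0 × ℝ => G p.1 p.2) :
    Measurable (bayesMean P t G) :=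
  (StronglyMeasurable.integral_prod_left (f := fun r x => G r x * bayesWeight P t r x)
    (μ := P.restrict (Set.Ioi t)) (hG.mul measurable_bayesWeight).stronglyMeasurable).measurable

/-- Each density has mass one and `P` is finite. By Fubini the normaliser is a genuine integral for
almost every `x`. -/
lemma integrable_bridgeDensity (ht : 0 < t) :
    Integrable (fun p : ℝ≥0 × ℝ => bridgeDensity t p.1 p.2)
      ((P.restrict (Set.Ioi t)).prod volume) := by
  have h := (measurable_bridgeDensity t).aestronglyMeasurable
    (μ := (P.restrict (Set.Ioi t)).prod volume)
  have ht' : (0 : ℝ) < t := NNReal.coe_pos.mpr ht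
  rw [integrable_prod_iff h]
  constructor
  · filter_upwards [ae_restrict_mem measurableSet_Ioi] with r hr
    exact integrable_betaPDFReal ht' (sub_pos.mpr (NNReal.coe_lt_coe.mpr hr))
  · refine (integrable_const (1 : ℝ)).congr ?_
    filter_upwards [ae_restrict_mem measurableSet_Ioi] with r hr
    simp_rw [Real.norm_of_nonneg (bridgeDensity_nonneg ht hr _)]
    exact (integral_betaPDFReal ht' (sub_pos.mpr (NNReal.coe_lt_coe.mpr hr))).symm

lemma ae_integrableOn_bridgeDensity (ht : 0 < t) :
    ∀ᵐ x : ℝ, IntegrableOn (fun r : ℝ≥0 => bridgeDensity t r x) (Set.Ioi t) P :=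
  (integrable_bridgeDensity ht).prod_left_ae

lemma setIntegral_setIntegral_bridgeDensity_mul_sub_bayesMean (ht : 0 < t) (hM0 : 0 ≤ M)
    (hG : Measurable fun p : ℝ≥0 × ℝ => G p.1 p.2) (hM : ∀ r x, |G r x| ≤ M) (C : Set ℝ) :
    ∫ r in Set.Ioi t, (∫ x in C, bridgeDensity t r x * (G r x - bayesMean P t G x)) ∂P = 0 := by
  rw [integral_integral_swap]
  · refine integral_eq_zero_of_ae (ae_restrict_of_ae ?_)
    filter_upwards [ae_integrableOn_bridgeDensity (P := P) ht] with x hx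
    exact setIntegral_bridgeDensity_mul_sub_bayesMean ht hG hM hx
  · have h1 : Integrable (fun p : ℝ≥0 × ℝ => bridgeDensity t p.1 p.2)
        ((P.restrict (Set.Ioi t)).prod (volume.restrict C)) :=
      (integrable_bridgeDensity ht).mono_measure (Measure.prod_mono le_rfl Measure.restrict_le_self)
    refine h1.mul_bdd (c := M + M) ?_ (Filter.Eventually.of_forall fun p => ?_)
    · exact (hG.sub ((measurable_bayesMean hG).comp measurable_snd)).aestronglyMeasurable
    · refine (norm_sub_le _ _).trans (add_le_add (hM _ _) (abs_bayesMean_le ht hM0 hM _))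

end Bayes

lemma indicator_congr_of_iff {α β : Type*} {A : Set α} {B : Set β} {f : α → ℝ} {g : β → ℝ} {a : α}
    {b : β} (h : b ∈ B ↔ a ∈ A) (hfg : a ∈ A → f a = g b) : A.indicator f a = B.indicator g b := by
  by_cases ha : a ∈ A
  · rw [Set.indicator_of_mem ha, Set.indicator_of_mem (h.mpr ha), hfg ha]
  · rw [Set.indicator_of_notMem ha, Set.indicator_of_notMem (mt h.mp ha)]

/-! ### Disintegration over the length -/

section Disintegration

variable {Ω : Type*} [MeasurableSpace Ω] {μ : Measure Ω} [IsProbabilityMeasure μ]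
  {γ : ℝ≥0 → Ω → ℝ} {τ : Ω → ℝ≥0} {t u : ℝ≥0}

/-- Integration over the random length, conditionally on which the process is a gamma bridge. -/
lemma setIntegral_randomGammaBridge [μ.IsComplete] (hγ : IsStandardGammaProcess γ μ)
    (hτ : Measurable τ) (hindep : IndepFun τ (fun ω t => γ t ω) μ) {H : ℝ≥0 × ℝ × ℝ → ℝ}
    (hH : Measurable H) {M : ℝ} (hM : ∀ p, |H p| ≤ M) {C : Set ℝ} (hC : MeasurableSet C) :
    ∫ ω in {ω | t < τ ω ∧ randomGammaBridge γ τ t ω ∈ C},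
        H (τ ω, randomGammaBridge γ τ t ω, randomGammaBridge γ τ u ω) ∂μ =
      ∫ r in Set.Ioi t, ∫ ω in {ω | γ t ω / γ r ω ∈ C},
        H (r, γ t ω / γ r ω, γ (min u r) ω / γ r ω) ∂μ ∂(μ.map τ) := by
  have hmp := hγ.measurable_path
  have := Measure.isProbabilityMeasure_map hτ.aemeasurable (μ := μ)
  have := Measure.isProbabilityMeasure_map hmp.aemeasurable (μ := μ)
  let b : ℝ≥0 → ℝ≥0 × (ℝ≥0 → ℝ) → ℝ := fun s q =>
    pathEval q.2 (min s q.1) / pathEval q.2 q.1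
  have hb : ∀ s, Measurable (b s) := fun s =>
    (measurable_snd.pathEval_comp (measurable_const.min measurable_fst)).div
      (measurable_snd.pathEval_comp measurable_fst)
  -- A jointly measurable function of the length and the path, whose joint law is a product by
  -- independence.
  let Ψ : ℝ≥0 × (ℝ≥0 → ℝ) → ℝ := fun q =>
    {q | t < q.1 ∧ b t q ∈ C}.indicator (fun q => H (q.1, b t q, b u q)) q
  have hset : MeasurableSet {q : ℝ≥0 × (ℝ≥0 → ℝ) | t < q.1 ∧ b t q ∈ C} :=
    (measurableSet_lt measurable_const measurable_fst).inter (hb t hC)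
  have hΨ : Measurable Ψ :=
    (hH.comp (measurable_fst.prodMk ((hb t).prodMk (hb u)))).indicator hset
  have hΨM : ∀ q, ‖Ψ q‖ ≤ M := fun q =>
    (norm_indicator_le_norm_self _ _).trans (hM _)
  have hbr : ∀ s, Measurable (randomGammaBridge γ τ s) := measurable_randomGammaBridge hγ hτ
  have hset2 : MeasurableSet {ω | t < τ ω ∧ randomGammaBridge γ τ t ω ∈ C} :=
    (measurableSet_lt measurable_const hτ).inter (hbr t hC)
  have e1 : ∫ ω in {ω | t < τ ω ∧ randomGammaBridge γ τ t ω ∈ C},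
        H (τ ω, randomGammaBridge γ τ t ω, randomGammaBridge γ τ u ω) ∂μ =
      ∫ ω, Ψ (τ ω, fun t => γ t ω) ∂μ := by
    rw [← integral_indicator hset2]
    refine integral_congr_ae ?_
    filter_upwards [hγ.ae_isGammaPath] with ω hp
    have : ∀ s, b s (τ ω, fun t => γ t ω) = randomGammaBridge γ τ s ω := by
      intro s
      simp only [b]
      rw [hp.pathEval_apply, hp.pathEval_apply]; rfl
    refine indicator_congr_of_iff ?_ ?_ <;> simp [this]
  have hlaw := (indepFun_iff_map_prod_eq_prod_map_map hτ.aemeasurable hmp.aemeasurable).mp hindep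
  have e2 : ∫ ω, Ψ (τ ω, fun t => γ t ω) ∂μ =
      ∫ q, Ψ q ∂((μ.map τ).prod (μ.map fun ω t => γ t ω)) := by
    rw [← hlaw, integral_map (hτ.prodMk hmp).aemeasurable hΨ.aestronglyMeasurable]
  rw [e1, e2, integral_prod _ (Integrable.of_bound hΨ.aestronglyMeasurable M
    (Filter.Eventually.of_forall hΨM)), ← integral_indicator measurableSet_Ioi]
  refine integral_congr_ae (Filter.Eventually.of_forall fun r => ?_)
  simp only
  rw [integral_map (f := fun p => Ψ (r, p)) hmp.aemeasurable
    (hΨ.comp measurable_prodMk_left).aestronglyMeasurable]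
  by_cases hr : t < r
  · have hset3 : MeasurableSet {ω | γ t ω / γ r ω ∈ C} :=
      ((hγ.measurable t).div (hγ.measurable r)) hC
    rw [Set.indicator_of_mem (show r ∈ Set.Ioi t from hr), ← integral_indicator hset3]
    refine integral_congr_ae ?_
    filter_upwards [hγ.ae_isGammaPath] with ω hp
    have h1 : ∀ s, b s (r, fun t => γ t ω) = γ (min s r) ω / γ r ω := by
      intro s
      simp only [b]
      rw [hp.pathEval_apply, hp.pathEval_apply]
    refine indicator_congr_of_iff ?_ ?_ <;> simp [h1, hr, min_eq_left hr.le]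
  · rw [Set.indicator_of_notMem (show r ∉ Set.Ioi t from hr)]
    refine integral_eq_zero_of_ae (Filter.Eventually.of_forall fun ω => ?_)
    exact Set.indicator_of_notMem (fun h => hr h.1) _

lemma IsStandardGammaProcess.setIntegral_bridge (hγ : IsStandardGammaProcess γ μ) (ht : 0 < t)
    {r : ℝ≥0} (hr : t < r) {k : ℝ → ℝ} (hk : Measurable k) {C : Set ℝ} (hC : MeasurableSet C) :
    ∫ ω in {ω | γ t ω / γ r ω ∈ C}, k (γ t ω / γ r ω) ∂μ =
      ∫ x in C, bridgeDensity t r x * k x := by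
  have h := setIntegral_map (μ := μ) (g := fun ω => γ t ω / γ r ω) (f := k) hC
    hk.aestronglyMeasurable ((hγ.measurable t).div (hγ.measurable r)).aemeasurable
  rw [hγ.map_bridge ht hr, setIntegral_betaMeasure (NNReal.coe_pos.mpr ht)
    (sub_pos.mpr (NNReal.coe_lt_coe.mpr hr)) k hC] at h
  exact h.symm

/-- `G r x` is the conditional expectation of `F` given that the bridge has length `r` and value
`x` at time `t`. -/
def IsBridgeMean (γ : ℝ≥0 → Ω → ℝ) (μ : Measure Ω) (t u : ℝ≥0) (F : ℝ≥0 × ℝ × ℝ → ℝ)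
    (G : ℝ≥0 → ℝ → ℝ) : Prop :=
  ∀ r, t < r → ∀ C, MeasurableSet C →
    ∫ ω in {ω | γ t ω / γ r ω ∈ C}, F (r, γ t ω / γ r ω, γ (min u r) ω / γ r ω) ∂μ =
      ∫ x in C, bridgeDensity t r x * G r x

/-- The conditional expectation given `ζ_t` alone on `{t < τ}`: for each length `r`, `hFG` turns `F`
into `G` against the bridge density, and the Bayes mean centres `G`. -/
lemma setIntegral_sub_bayesMean [μ.IsComplete] (hγ : IsStandardGammaProcess γ μ)
    (hτ : Measurable τ) (hindep : IndepFun τ (fun ω t => γ t ω) μ) (ht : 0 < t)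
    {F : ℝ≥0 × ℝ × ℝ → ℝ} {G : ℝ≥0 → ℝ → ℝ} (hF : Measurable F)
    (hG : Measurable fun p : ℝ≥0 × ℝ => G p.1 p.2) {M : ℝ} (hM0 : 0 ≤ M) (hFM : ∀ p, |F p| ≤ M)
    (hGM : ∀ r x, |G r x| ≤ M) (hFG : IsBridgeMean γ μ t u F G) {C : Set ℝ}
    (hC : MeasurableSet C) :
    ∫ ω in {ω | t < τ ω ∧ randomGammaBridge γ τ t ω ∈ C},
        (F (τ ω, randomGammaBridge γ τ t ω, randomGammaBridge γ τ u ω) -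
          bayesMean (μ.map τ) t G (randomGammaBridge γ τ t ω)) ∂μ = 0 := by
  have := Measure.isProbabilityMeasure_map hτ.aemeasurable (μ := μ)
  have hK := measurable_bayesMean (P := μ.map τ) (t := t) hG
  have hKM := abs_bayesMean_le (P := μ.map τ) ht hM0 hGM
  rw [setIntegral_randomGammaBridge (u := u)
    (H := fun p => F p - bayesMean (μ.map τ) t G p.2.1) hγ hτ hindep
    (hF.sub (hK.comp (by fun_prop))) (M := M + M)
    (fun p => (abs_sub _ _).trans (add_le_add (hFM _) (hKM _))) hC]
  rw [← setIntegral_setIntegral_bridgeDensity_mul_sub_bayesMean (P := μ.map τ) ht hM0 hG hGM C]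
  refine setIntegral_congr_fun measurableSet_Ioi fun r hr => ?_
  have hr : t < r := hr
  have hm := hγ.measurable
  have hq : ∀ s, Measurable fun ω => γ s ω / γ r ω := fun s => (hm s).div (hm r)
  have hi := integrable_betaPDFReal (NNReal.coe_pos.mpr ht)
    (sub_pos.mpr (NNReal.coe_lt_coe.mpr hr))
  have hi' : Integrable (fun x => bridgeDensity t r x) := hi
  simp only
  rw [integral_sub, hFG r hr C hC, hγ.setIntegral_bridge ht hr hK hC, ← integral_sub]
  · simp_rw [mul_sub]
  · exact (hi'.mul_bdd (c := M) (hG.comp measurable_prodMk_left).aestronglyMeasurable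
      (Filter.Eventually.of_forall fun x => hGM r x)).integrableOn
  · exact (hi'.mul_bdd (c := M) hK.aestronglyMeasurable
      (Filter.Eventually.of_forall fun x => hKM x)).integrableOn
  · exact Integrable.of_bound (hF.comp (measurable_const.prodMk
      ((hq t).prodMk (hq (min u r))))).aestronglyMeasurable M
      (Filter.Eventually.of_forall fun x => hFM _)
  · exact Integrable.of_bound (hK.comp (hq t)).aestronglyMeasurable M
      (Filter.Eventually.of_forall fun x => hKM _)

end Disintegration

/-! ### From the present value to the whole past -/

section Conditioning

variable {Ω : Type*} [MeasurableSpace Ω] {μ : Measure Ω} [IsProbabilityMeasure μ]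

/-- If `H(Y)` has zero conditional mean given `z(Y)`, information independent of `Y` does not change
this: with `B` frozen by Fubini, the event depends on `z(Y)` alone. -/
lemma setIntegral_eq_zero_of_indepFun {E D E' : Type*} [MeasurableSpace E] [MeasurableSpace D]
    [MeasurableSpace E'] {B : Ω → E} {Y : Ω → D} (hB : Measurable B) (hY : Measurable Y)
    (hBY : IndepFun B Y μ) {z : D → ℝ} (hz : Measurable z) {H : D → ℝ} (hH : Measurable H) {M : ℝ}
    (hM : ∀ y, |H y| ≤ M) {Φ : E × ℝ → E'} (hΦ : Measurable Φ) {S : Set E'} (hS : MeasurableSet S)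
    (h : ∀ C, MeasurableSet C → ∫ ω in {ω | z (Y ω) ∈ C}, H (Y ω) ∂μ = 0) :
    ∫ ω in {ω | Φ (B ω, z (Y ω)) ∈ S}, H (Y ω) ∂μ = 0 := by
  have := Measure.isProbabilityMeasure_map hB.aemeasurable (μ := μ)
  have := Measure.isProbabilityMeasure_map hY.aemeasurable (μ := μ)
  have hset : MeasurableSet {q : E × D | Φ (q.1, z q.2) ∈ S} :=
    (hΦ.comp (measurable_fst.prodMk (hz.comp measurable_snd))) hS
  have hlaw := (indepFun_iff_map_prod_eq_prod_map_map hB.aemeasurable hY.aemeasurable).mp hBY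
  have e1 := setIntegral_map (μ := μ) (g := fun ω => (B ω, Y ω)) (f := fun q => H q.2) hset
    (hH.comp measurable_snd).aestronglyMeasurable (hB.prodMk hY).aemeasurable
  have hind : Measurable ({q : E × D | Φ (q.1, z q.2) ∈ S}.indicator fun q => H q.2) :=
    (hH.comp measurable_snd).indicator hset
  change _ = ∫ ω in {ω | Φ (B ω, z (Y ω)) ∈ S}, H (Y ω) ∂μ at e1
  rw [← e1, hlaw, ← integral_indicator hset, integral_prod _
    (Integrable.of_bound hind.aestronglyMeasurable M
      (Filter.Eventually.of_forall fun q => (norm_indicator_le_norm_self _ _).trans (hM _)))]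
  refine integral_eq_zero_of_ae (Filter.Eventually.of_forall fun b => ?_)
  simp only [Pi.zero_apply]
  have hC : MeasurableSet {x : ℝ | Φ (b, x) ∈ S} := (hΦ.comp measurable_prodMk_left) hS
  rw [← h _ hC]
  have e2 := setIntegral_map (μ := μ) (g := Y) (f := H) (hz hC) hH.aestronglyMeasurable
    hY.aemeasurable
  change _ = ∫ ω in {ω | z (Y ω) ∈ {x : ℝ | Φ (b, x) ∈ S}}, H (Y ω) ∂μ at e2
  rw [← e2, ← integral_indicator (hz hC)]
  rfl

variable {γ : ℝ≥0 → Ω → ℝ} {τ : Ω → ℝ≥0} {t u : ℝ≥0}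

/-- Given the value of the bridge at time `t < τ`, its past is irrelevant for its future and for its
length. -/
lemma setIntegral_past_eq_zero [μ.IsComplete] (hγ : IsStandardGammaProcess γ μ)
    (hτ : Measurable τ) (hindep : IndepFun τ (fun ω t => γ t ω) μ) (ht : 0 < t) (htu : t < u)
    {F : ℝ≥0 × ℝ × ℝ → ℝ} (hF : Measurable F) {M : ℝ} (hM : ∀ p, |F p| ≤ M)
    (h : ∀ C, MeasurableSet C → ∫ ω in {ω | t < τ ω ∧ randomGammaBridge γ τ t ω ∈ C},
      F (τ ω, randomGammaBridge γ τ t ω, randomGammaBridge γ τ u ω) ∂μ = 0)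
    {S : Set (Set.Iic t → ℝ)} (hS : MeasurableSet S) :
    ∫ ω in {ω | t < τ ω ∧ (fun s : Set.Iic t => randomGammaBridge γ τ s ω) ∈ S},
      F (τ ω, randomGammaBridge γ τ t ω, randomGammaBridge γ τ u ω) ∂μ = 0 := by
  have hm := hγ.measurable
  have hB : Measurable fun ω (s : Set.Iic t) => γ s ω / γ t ω :=
    measurable_pi_lambda _ fun s => (hm s).div (hm t)
  have hY : Measurable fun ω => ((γ t ω, fun h : ℝ≥0 => γ (t + h) ω - γ t ω), τ ω) :=
    ((hm t).prodMk (measurable_pi_lambda _ fun h => (hm _).sub (hm t))).prodMk hτ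
  -- The bridge at times `s ≥ t` on `{t < τ}`, written through `γ_t`, the later increments and `τ`.
  let b : ℝ≥0 → (ℝ × (ℝ≥0 → ℝ)) × ℝ≥0 → ℝ := fun s y =>
    (y.1.1 + pathEval y.1.2 (min s y.2 - t)) / (y.1.1 + pathEval y.1.2 (y.2 - t))
  have hev : ∀ f : ℝ≥0 → ℝ≥0, Measurable f → Measurable fun y : (ℝ × (ℝ≥0 → ℝ)) × ℝ≥0 =>
      y.1.1 + pathEval y.1.2 (f y.2) := fun f hf =>
    (measurable_fst.comp measurable_fst).add
      ((measurable_snd.comp measurable_fst).pathEval_comp (hf.comp measurable_snd))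
  have hb : ∀ s, Measurable (b s) := fun s =>
    (hev _ ((measurable_const.min measurable_id).sub measurable_const)).div
      (hev _ (measurable_id.sub measurable_const))
  have hset : MeasurableSet {y : (ℝ × (ℝ≥0 → ℝ)) × ℝ≥0 | t < y.2} :=
    measurableSet_lt measurable_const measurable_snd
  let H : (ℝ × (ℝ≥0 → ℝ)) × ℝ≥0 → ℝ :=
    {y | t < y.2}.indicator fun y => F (y.2, b t y, b u y)
  have hH : Measurable H :=
    (hF.comp (measurable_snd.prodMk ((hb t).prodMk (hb u)))).indicator hset
  have hbr : ∀ s, Measurable (randomGammaBridge γ τ s) := measurable_randomGammaBridge hγ hτ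
  have hbY : ∀ s, t ≤ s → ∀ ω, (IsGammaPath fun t => γ t ω) → t < τ ω →
      b s ((γ t ω, fun h : ℝ≥0 => γ (t + h) ω - γ t ω), τ ω) = randomGammaBridge γ τ s ω := by
    intro s hs ω hp hω
    simp only [b]
    rw [hp.pathEval_shift hω.le, hp.pathEval_shift (le_min hs hω.le), add_sub_cancel,
      add_sub_cancel]
    rfl
  have hbY2 : ∀ s, Measurable fun ω =>
      b s ((γ t ω, fun h : ℝ≥0 => γ (t + h) ω - γ t ω), τ ω) := fun s => (hb s).comp hY
  have hset2 : MeasurableSet {ω | t < τ ω} := measurableSet_lt measurable_const hτ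
  -- Rebuilds the past of the bridge from `ζ_s = (γ_s / γ_t) ζ_t`.
  let Φ : (Set.Iic t → ℝ) × ℝ → Set.Iic t → ℝ := fun q s => q.1 s * q.2
  have hΦ : Measurable Φ := by
    refine measurable_pi_lambda _ fun s => ?_
    exact ((measurable_pi_apply s).comp measurable_fst).mul measurable_snd
  have hpast : Measurable fun ω (s : Set.Iic t) => randomGammaBridge γ τ s ω :=
    measurable_pi_lambda _ fun s => hbr s
  have key := setIntegral_eq_zero_of_indepFun hB hY (hγ.indepFun_bridge hτ hindep t) (hb t) hH
    (M := M) (fun y => show ‖H y‖ ≤ M from (norm_indicator_le_norm_self _ _).trans (hM _)) hΦ hS (fun C hC => ?_)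
  · have hA1 : MeasurableSet
        {ω | t < τ ω ∧ (fun s : Set.Iic t => randomGammaBridge γ τ s ω) ∈ S} :=
      hset2.inter (hpast hS)
    have hA2 : MeasurableSet {ω | Φ ((fun s : Set.Iic t => γ s ω / γ t ω),
        b t ((γ t ω, fun h : ℝ≥0 => γ (t + h) ω - γ t ω), τ ω)) ∈ S} :=
      (hΦ.comp (hB.prodMk (hbY2 t))) hS
    rw [← key, ← integral_indicator hA1, ← integral_indicator hA2]
    refine integral_congr_ae ?_
    filter_upwards [hγ.ae_isGammaPath] with ω hp
    by_cases hω : t < τ ω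
    · have e1 := hbY t le_rfl ω hp hω
      have e2 := hbY u htu.le ω hp hω
      have e3 : Φ ((fun s : Set.Iic t => γ s ω / γ t ω), randomGammaBridge γ τ t ω) =
          fun s : Set.Iic t => randomGammaBridge γ τ s ω := by
        ext s
        have hs : (s : ℝ≥0) < τ ω := lt_of_le_of_lt s.2 hω
        simp only [Φ]
        rw [randomGammaBridge_of_lt hω, randomGammaBridge_of_lt hs,
          div_mul_div_cancel₀ (hp.pos ht).ne']
      refine indicator_congr_of_iff ?_ ?_
      · simp only [Set.mem_ofPred_eq, hω, true_and, e1, e3]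
      · intro _
        simp only [H]
        rw [Set.indicator_of_mem (by exact hω), e1, e2]
    -- The two events may differ off `{t < τ}`, where `H` is zero.
    · rw [Set.indicator_of_notMem (s := {ω | t < τ ω ∧ (fun s : Set.Iic t => randomGammaBridge γ τ s ω) ∈ S})
        (fun hmem => hω hmem.1)]
      have : H ((γ t ω, fun h : ℝ≥0 => γ (t + h) ω - γ t ω), τ ω) = 0 :=
        Set.indicator_of_notMem (by exact hω) _
      simp [Set.indicator, this]
  · have hA1 : MeasurableSet {ω | t < τ ω ∧ randomGammaBridge γ τ t ω ∈ C} :=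
      hset2.inter (hbr t hC)
    have hA2 : MeasurableSet {ω | b t ((γ t ω, fun h : ℝ≥0 => γ (t + h) ω - γ t ω), τ ω) ∈ C} :=
      hbY2 t hC
    rw [← h C hC, ← integral_indicator hA1, ← integral_indicator hA2]
    refine integral_congr_ae ?_
    filter_upwards [hγ.ae_isGammaPath] with ω hp
    by_cases hω : t < τ ω
    · have e1 := hbY t le_rfl ω hp hω
      have e2 := hbY u htu.le ω hp hω
      refine indicator_congr_of_iff ?_ ?_
      · simp only [Set.mem_ofPred_eq, hω, true_and, e1]
      · intro _
        simp only [H]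
        rw [Set.indicator_of_mem (by exact hω), e1, e2]
    · rw [Set.indicator_of_notMem (s := {ω | t < τ ω ∧ randomGammaBridge γ τ t ω ∈ C})
        (fun hmem => hω hmem.1)]
      have : H ((γ t ω, fun h : ℝ≥0 => γ (t + h) ω - γ t ω), τ ω) = 0 :=
        Set.indicator_of_notMem (by exact hω) _
      simp [Set.indicator, this]

/-- For `s < t`, the event `{τ ∧ t ≤ s}` is almost surely `{ζ_s = 1}`. -/
lemma measurable_min_completedNatural [μ.IsComplete] (hγ : IsStandardGammaProcess γ μ)
    (hτpos : ∀ ω, 0 < τ ω) :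
    Measurable[completedNatural (randomGammaBridge γ τ) μ t] fun ω => min (τ ω) t := by
  refine @measurable_of_Iic _ _ _ _ _ _ _ _ _ _ fun s => ?_
  rcases le_or_gt t s with hs | hs
  · have : (fun ω => min (τ ω) t) ⁻¹' Set.Iic s = Set.univ := by
      ext ω; simp [hs]
    rw [this]
    exact @MeasurableSet.univ _ (_)
  · refine measurableSet_completedNatural_of_ae_eq
      (measurable_completedNatural (μ := μ) (Y := randomGammaBridge γ τ) hs.le
        (measurableSet_singleton (1 : ℝ))) ?_
    filter_upwards [hγ.ae_isGammaPath] with ω hp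
    refine propext ?_
    change min (τ ω) t ≤ s ↔ randomGammaBridge γ τ s ω = 1
    rw [randomGammaBridge_eq_one_iff hp (hτpos ω), min_le_iff]
    simp [hs.not_ge]

/-- The conditional expectation of a function of the length of the bridge, its present value and a
future one, given the past of the bridge. -/
theorem condExp_randomGammaBridge [μ.IsComplete] (hγ : IsStandardGammaProcess γ μ)
    (hτ : Measurable τ) (hτpos : ∀ ω, 0 < τ ω) (hindep : IndepFun τ (fun ω t => γ t ω) μ)
    (ht : 0 < t) (htu : t < u) {F : ℝ≥0 × ℝ × ℝ → ℝ} {G : ℝ≥0 → ℝ → ℝ} (hF : Measurable F)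
    (hG : Measurable fun p : ℝ≥0 × ℝ => G p.1 p.2) {M : ℝ} (hM0 : 0 ≤ M) (hFM : ∀ p, |F p| ≤ M)
    (hGM : ∀ r x, |G r x| ≤ M) (hFG : IsBridgeMean γ μ t u F G) :
    μ[fun ω => F (τ ω, randomGammaBridge γ τ t ω, randomGammaBridge γ τ u ω) |
        completedNatural (randomGammaBridge γ τ) μ t] =ᵐ[μ]
      fun ω =>
        {ω | randomGammaBridge γ τ t ω = 1}.indicator (fun ω => F (min (τ ω) t, 1, 1)) ω +
        {ω | randomGammaBridge γ τ t ω ∈ Set.Ioo 0 1}.indicator (fun ω =>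
          bayesMean (μ.map τ) t G (randomGammaBridge γ τ t ω)) ω := by
  have := Measure.isProbabilityMeasure_map hτ.aemeasurable (μ := μ)
  have hbr : ∀ s, Measurable (randomGammaBridge γ τ s) := measurable_randomGammaBridge hγ hτ
  have hm := completedNatural_le (μ := μ) hbr t
  have hK := measurable_bayesMean (P := μ.map τ) (t := t) hG
  have hKM := abs_bayesMean_le (P := μ.map τ) ht hM0 hGM
  have hζt : Measurable[completedNatural (randomGammaBridge γ τ) μ t] (randomGammaBridge γ τ t) :=
    measurable_completedNatural (μ := μ) (Y := randomGammaBridge γ τ) le_rfl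
  set f := fun ω => F (τ ω, randomGammaBridge γ τ t ω, randomGammaBridge γ τ u ω) with hf
  set R := fun ω =>
        {ω | randomGammaBridge γ τ t ω = 1}.indicator (fun ω => F (min (τ ω) t, 1, 1)) ω +
        {ω | randomGammaBridge γ τ t ω ∈ Set.Ioo 0 1}.indicator (fun ω =>
          bayesMean (μ.map τ) t G (randomGammaBridge γ τ t ω)) ω with hR
  have hRm : Measurable[completedNatural (randomGammaBridge γ τ) μ t] R := by
    refine Measurable.add (Measurable.indicator ?_ ?_) (Measurable.indicator ?_ ?_)
    · exact hF.comp (Measurable.prodMk (measurable_min_completedNatural hγ hτpos) measurable_const)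
    · exact hζt (measurableSet_singleton (1 : ℝ))
    · exact hK.comp hζt
    · exact hζt measurableSet_Ioo
  have hfm : Measurable f := hF.comp (hτ.prodMk ((hbr t).prodMk (hbr u)))
  have hfi : Integrable f μ := Integrable.of_bound hfm.aestronglyMeasurable M
    (Filter.Eventually.of_forall fun ω => hFM _)
  have hRi : Integrable R μ := by
    refine Integrable.of_bound (hRm.mono hm le_rfl).aestronglyMeasurable (M + M)
      (Filter.Eventually.of_forall fun ω => ?_)
    refine (norm_add_le _ _).trans (add_le_add ?_ ?_)
    · exact (norm_indicator_le_norm_self _ _).trans (hFM _)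
    · exact (norm_indicator_le_norm_self _ _).trans (hKM _)
  refine (ae_eq_condExp_of_forall_setIntegral_eq hm hfi (fun _ _ _ => hRi.integrableOn)
    (fun A hA _ => ?_) hRm.aestronglyMeasurable).symm
  obtain ⟨S, hS, hAS⟩ := exists_measurableSet_of_completedNatural hA
  rw [setIntegral_congr_set hAS, setIntegral_congr_set hAS, eq_comm, ← sub_eq_zero,
    ← integral_sub hfi.integrableOn hRi.integrableOn]
  have h0 := setIntegral_past_eq_zero (M := M + M) hγ hτ hindep ht htu
    (F := fun p => F p - bayesMean (μ.map τ) t G p.2.1) (hF.sub (hK.comp (by fun_prop)))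
    (fun p => (abs_sub _ _).trans (add_le_add (hFM _) (hKM _)))
    (fun C hC => setIntegral_sub_bayesMean hγ hτ hindep ht hF hG hM0 hFM hGM hFG hC) hS
  have hpast : Measurable fun ω (s : Set.Iic t) => randomGammaBridge γ τ s ω :=
    measurable_pi_lambda _ fun s => hbr s
  have hset1 : MeasurableSet {ω | (fun s : Set.Iic t => randomGammaBridge γ τ s ω) ∈ S} := hpast hS
  have hset2 : MeasurableSet {ω | t < τ ω} := measurableSet_lt measurable_const hτ
  have hset3 : MeasurableSet
      {ω | t < τ ω ∧ (fun s : Set.Iic t => randomGammaBridge γ τ s ω) ∈ S} :=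
    hset2.inter hset1
  rw [← h0, ← integral_indicator hset1, ← integral_indicator hset3]
  refine integral_congr_ae ?_
  filter_upwards [hγ.ae_isGammaPath] with ω hp
  by_cases hω : t < τ ω
  · have h1 := (randomGammaBridge_mem_Ioo_iff hp (hτpos ω) ht).mpr hω
    refine indicator_congr_of_iff ?_ fun _ => ?_
    · simp [hω]
    · simp only [hf, hR]
      rw [Set.indicator_of_notMem (by exact h1.2.ne), Set.indicator_of_mem (by exact h1), zero_add]
  · rw [Set.indicator_of_notMem
      (s := {ω | t < τ ω ∧ (fun s : Set.Iic t => randomGammaBridge γ τ s ω) ∈ S})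
      (fun hmem => hω hmem.1)]
    have h1 := randomGammaBridge_of_le hp (hτpos ω) (not_lt.mp hω)
    have h2 := randomGammaBridge_of_le hp (hτpos ω) ((not_lt.mp hω).trans htu.le)
    -- Once `τ ≤ t`, both bridge values are `1` and `τ ∧ t = τ`, so the formula is exact.
    have : f ω - R ω = 0 := by
      simp only [hf, hR]
      rw [Set.indicator_of_mem (by exact h1), Set.indicator_of_notMem (by
        rw [Set.mem_ofPred_eq, h1]; simp), h1, h2, min_eq_left (not_lt.mp hω)]
      simp
    simp [Set.indicator, this]

end Conditioning

/-! ### Conditional means of the bridge at present and future times -/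

section BridgeMeans

/-- The mean of `g r` under the law at time `u` of the gamma bridge of length `r` that has value `x`
at time `t`. -/
noncomputable def bridgeFutureMean (t u : ℝ≥0) (g : ℝ≥0 → ℝ → ℝ) (r : ℝ≥0) (x : ℝ) : ℝ :=
  if r ≤ u then g r 1 else ∫ b, betaPDFReal (u - t) (r - u) b * g r ((1 - x) * b + x)

variable {t u : ℝ≥0} {g : ℝ≥0 → ℝ → ℝ} {M : ℝ}

lemma measurable_bridgeFutureMean (hg : Measurable fun p : ℝ≥0 × ℝ => g p.1 p.2) :
    Measurable fun p : ℝ≥0 × ℝ => bridgeFutureMean t u g p.1 p.2 := by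
  refine Measurable.ite (measurableSet_le measurable_fst measurable_const)
    (hg.comp (measurable_fst.prodMk measurable_const)) ?_
  refine (StronglyMeasurable.integral_prod_right' (f := fun q : (ℝ≥0 × ℝ) × ℝ =>
    betaPDFReal (u - t) (q.1.1 - u) q.2 * g q.1.1 ((1 - q.1.2) * q.2 + q.1.2))
    (Measurable.stronglyMeasurable ?_)).measurable
  refine Measurable.mul (Measurable.betaPDFReal_comp measurable_const (by fun_prop) (by fun_prop)) ?_
  exact hg.comp (f := fun q : (ℝ≥0 × ℝ) × ℝ => (q.1.1, (1 - q.1.2) * q.2 + q.1.2)) (by fun_prop)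

lemma abs_bridgeFutureMean_le (htu : t < u) (hM : ∀ r x, |g r x| ≤ M) (r : ℝ≥0) (x : ℝ) :
    |bridgeFutureMean t u g r x| ≤ M := by
  unfold bridgeFutureMean
  split_ifs with hr
  · exact hM r 1
  · have h1 : (0 : ℝ) < u - t := sub_pos.mpr (NNReal.coe_lt_coe.mpr htu)
    have h2 : (0 : ℝ) < r - u := sub_pos.mpr (NNReal.coe_lt_coe.mpr (not_le.mp hr))
    have := isProbabilityMeasureBeta h1 h2
    rw [← integral_betaMeasure h1 h2]
    have := norm_integral_le_of_norm_le_const (μ := betaMeasure ((u : ℝ) - t) (r - u))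
      (f := fun b => g r ((1 - x) * b + x)) (C := M) (Filter.Eventually.of_forall fun b => hM _ _)
    simpa using this

/-- The beta form is bounded and jointly measurable for all `x`; for `x < 1` an affine change of
variable identifies it with the transition law. -/
lemma bridgeFutureMean_eq_integral (htu : t < u) (hg : Measurable fun p : ℝ≥0 × ℝ => g p.1 p.2)
    {r : ℝ≥0} (hr : u < r) {x : ℝ} (hx : x < 1) :
    bridgeFutureMean t u g r x = ∫ y, g r y ∂bridgeTransition t u r x := by
  have h1 : (0 : ℝ) < u - t := sub_pos.mpr (NNReal.coe_lt_coe.mpr htu)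
  have h2 : (0 : ℝ) < r - u := sub_pos.mpr (NNReal.coe_lt_coe.mpr hr)
  rw [bridgeFutureMean, if_neg hr.not_ge, bridgeTransition_eq_map hx,
    integral_map (f := g r) (by fun_prop)
    (hg.comp measurable_prodMk_left).aestronglyMeasurable, integral_betaMeasure h1 h2]

variable {Ω : Type*} [MeasurableSpace Ω] {μ : Measure Ω} [IsProbabilityMeasure μ]
  {γ : ℝ≥0 → Ω → ℝ}

lemma isBridgeMean_present (hγ : IsStandardGammaProcess γ μ) (ht : 0 < t)
    (hg : Measurable fun p : ℝ≥0 × ℝ => g p.1 p.2) :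
    IsBridgeMean γ μ t u (fun p => g p.1 p.2.1) g := fun _ hr _ hC =>
  hγ.setIntegral_bridge ht hr (hg.comp measurable_prodMk_left) hC

/-- If `r ≤ u` the bridge has already reached `1`. Otherwise `ζʳ_u = (1 - ζʳ_t) B + ζʳ_t` with `B`
an independent beta variable, and Fubini integrates `B` out. -/
lemma isBridgeMean_future (hγ : IsStandardGammaProcess γ μ) (ht : 0 < t) (htu : t < u)
    (hg : Measurable fun p : ℝ≥0 × ℝ => g p.1 p.2) (hM : ∀ r x, |g r x| ≤ M) :
    IsBridgeMean γ μ t u (fun p => g p.1 p.2.2) (bridgeFutureMean t u g) := by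
  intro r hr C hC
  have hm := hγ.measurable
  have hZ : Measurable fun ω => γ t ω / γ r ω := (hm t).div (hm r)
  have hset : MeasurableSet {ω | γ t ω / γ r ω ∈ C} := hZ hC
  rcases le_or_gt r u with hru | hru
  · have h1 := hγ.setIntegral_bridge ht hr (k := fun _ => g r 1) measurable_const hC
    simp only [bridgeFutureMean, if_pos hru]
    rw [← h1]
    refine setIntegral_congr_ae hset ?_
    filter_upwards [hγ.ae_isGammaPath] with ω hp _
    rw [min_eq_right hru, div_self (hp.pos (ht.trans hr)).ne']
  · obtain ⟨hB, hind⟩ := hγ.bridge_increment htu hru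
    have hBm : Measurable fun ω => (γ u ω - γ t ω) / (γ r ω - γ t ω) :=
      ((hm u).sub (hm t)).div ((hm r).sub (hm t))
    have h1 : (0 : ℝ) < u - t := sub_pos.mpr (NNReal.coe_lt_coe.mpr htu)
    have h2 : (0 : ℝ) < r - u := sub_pos.mpr (NNReal.coe_lt_coe.mpr hru)
    have h3 : (0 : ℝ) < r - t := sub_pos.mpr (NNReal.coe_lt_coe.mpr hr)
    have := isProbabilityMeasureBeta h1 h2
    have := isProbabilityMeasureBeta (NNReal.coe_pos.mpr ht) h3
    have hlaw := (indepFun_iff_map_prod_eq_prod_map_map hZ.aemeasurable hBm.aemeasurable).mp hind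
    rw [hB, hγ.map_bridge ht hr] at hlaw
    have hk : Measurable fun q : ℝ × ℝ => g r ((1 - q.1) * q.2 + q.1) :=
      hg.comp (f := fun q : ℝ × ℝ => (r, (1 - q.1) * q.2 + q.1)) (by fun_prop)
    have hCm : MeasurableSet {q : ℝ × ℝ | q.1 ∈ C} := measurable_fst hC
    have e1 := setIntegral_map (μ := μ)
      (g := fun ω => (γ t ω / γ r ω, (γ u ω - γ t ω) / (γ r ω - γ t ω)))
      (f := fun q : ℝ × ℝ => g r ((1 - q.1) * q.2 + q.1)) hCm
      hk.aestronglyMeasurable (hZ.prodMk hBm).aemeasurable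
    have e2 : ∫ ω in {ω | γ t ω / γ r ω ∈ C}, g r (γ (min u r) ω / γ r ω) ∂μ =
        ∫ q in {q : ℝ × ℝ | q.1 ∈ C}, g r ((1 - q.1) * q.2 + q.1)
          ∂(betaMeasure t ((r : ℝ) - t)).prod (betaMeasure ((u : ℝ) - t) ((r : ℝ) - u)) := by
      rw [← hlaw, e1]
      refine setIntegral_congr_ae hset ?_
      filter_upwards [hγ.ae_isGammaPath] with ω hp _
      have hr0 := (hp.pos (ht.trans hr)).ne'
      have hrt := (sub_pos.mpr (hp.strictMono hr)).ne'
      rw [min_eq_left hru.le]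
      congr 1
      field_simp
      ring
    simp only
    rw [e2, ← integral_indicator hCm, integral_prod _ (Integrable.of_bound
      (hk.indicator hCm).aestronglyMeasurable M (Filter.Eventually.of_forall fun q =>
        (norm_indicator_le_norm_self _ _).trans (hM _ _)))]
    have e3 := setIntegral_betaMeasure (NNReal.coe_pos.mpr ht) h3 (bridgeFutureMean t u g r) hC
    simp only [bridgeDensity]
    rw [← e3, ← integral_indicator hC]
    refine integral_congr_ae (Filter.Eventually.of_forall fun x => ?_)
    by_cases hx : x ∈ C
    · simp only [Set.indicator, Set.mem_ofPred_eq, hx, if_true, bridgeFutureMean,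
        if_neg hru.not_ge]
      exact integral_betaMeasure h1 h2 _
    · simp [Set.indicator, hx]

end BridgeMeans

/-! ### Splitting at `u`, extension of test functions, and the theorem -/

section Splitting

variable {P : Measure ℝ≥0} {t u : ℝ≥0} {G : ℝ≥0 → ℝ → ℝ} {M : ℝ}

/-- Integrability holds for every `x`: where the density is not integrable, all weights are zero. -/
lemma bayesMean_eq_add (htu : t < u) (hG : Measurable fun p : ℝ≥0 × ℝ => G p.1 p.2)
    (hM : ∀ r x, |G r x| ≤ M) (x : ℝ) :
    bayesMean P t G x = ∫ r in Set.Ioc t u, G r x * bayesWeight P t r x ∂P +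
      ∫ r in Set.Ioi u, G r x * bayesWeight P t r x ∂P := by
  have hint : IntegrableOn (fun r => G r x * bayesWeight P t r x) (Set.Ioi t) P := by
    by_cases hx : IntegrableOn (fun r : ℝ≥0 => bridgeDensity t r x) (Set.Ioi t) P
    · have := (integrableOn_mul_bridgeDensity hG hM hx).div_const
        (∫ s in Set.Ioi t, bridgeDensity t s x ∂P)
      simp only [mul_div_assoc] at this
      exact this
    · have h0 : ∀ r : ℝ≥0, G r x * bayesWeight P t r x = 0 := fun r => by
        rw [bayesWeight, integral_undef (f := fun r : ℝ≥0 => bridgeDensity t r x) hx, div_zero,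
          mul_zero]
      simp only [h0]
      exact integrableOn_zero
  rw [bayesMean, ← Set.Ioc_union_Ioi_eq_Ioi htu.le, setIntegral_union _ measurableSet_Ioi]
  · exact hint.mono_set Set.Ioc_subset_Ioi_self
  · exact hint.mono_set (Set.Ioi_subset_Ioi htu.le)
  · rw [Set.disjoint_left]
    exact fun r hr hr' => (not_lt.mpr hr.2) hr'

/-- A bounded measurable function on `(0, ∞) × ℝ` has a bounded measurable extension. -/
lemma exists_bounded_measurable_extension {g : ℝ≥0 → ℝ → ℝ}
    (hg : Measurable (fun p : Set.Ioi (0 : ℝ≥0) × ℝ => g p.1 p.2))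
    (hC : ∃ C, ∀ r y, 0 < r → |g r y| ≤ C) :
    ∃ (g' : ℝ≥0 → ℝ → ℝ) (M : ℝ), 0 ≤ M ∧ Measurable (fun p : ℝ≥0 × ℝ => g' p.1 p.2) ∧
      (∀ r y, |g' r y| ≤ M) ∧ ∀ r, 0 < r → ∀ y, g' r y = g r y := by
  obtain ⟨C, hC⟩ := hC
  have hC0 : 0 ≤ C := (abs_nonneg _).trans (hC 1 0 one_pos)
  have he : MeasurableEmbedding (fun p : Set.Ioi (0 : ℝ≥0) × ℝ => ((p.1 : ℝ≥0), p.2)) :=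
    (MeasurableEmbedding.subtype_coe measurableSet_Ioi).prodMap MeasurableEmbedding.id
  obtain ⟨f, hf, hfg⟩ := he.exists_measurable_extend hg fun _ => inferInstance
  -- Truncation to `[-C, C]` bounds the extension everywhere without changing it for `r > 0`.
  refine ⟨fun r y => max (-C) (min C (f (r, y))), C, hC0, ?_, fun r y => ?_, fun r hr y => ?_⟩
  · exact measurable_const.max (measurable_const.min hf)
  · rw [abs_le]
    exact ⟨le_max_left _ _, max_le (by linarith) (min_le_left _ _)⟩
  · have h1 : f (r, y) = g r y := congrFun hfg (⟨r, hr⟩, y)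
    have h2 := abs_le.mp (hC r y hr)
    simp only [h1]
    rw [min_eq_right h2.2, max_eq_right h2.1]

end Splitting

theorem mainTheorem5 {Ω : Type*} [MeasurableSpace Ω] (μ : Measure Ω) [IsProbabilityMeasure μ]
    [μ.IsComplete] (γ : ℝ≥0 → Ω → ℝ) (hγ : IsStandardGammaProcess γ μ)
    (τ : Ω → ℝ≥0) (hτ : Measurable τ) (hτpos : ∀ ω, 0 < τ ω)
    (hindep : IndepFun τ (fun ω t => γ t ω) μ)
    (t u : ℝ≥0) (ht : 0 < t) (htu : t < u) :
    (∀ g : ℝ≥0 → ℝ, Measurable (fun r : Set.Ioi (0 : ℝ≥0) => g r) →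
      (∃ C, ∀ r, 0 < r → |g r| ≤ C) →
      μ[fun ω => g (τ ω) | completedNatural (randomGammaBridge γ τ) μ t] =ᵐ[μ]
        fun ω =>
          {ω | randomGammaBridge γ τ t ω = 1}.indicator (fun ω => g (min (τ ω) t)) ω +
          {ω | randomGammaBridge γ τ t ω ∈ Set.Ioo 0 1}.indicator (fun ω =>
            ∫ r in Set.Ioi t,
              g r * bayesWeight (μ.map τ) t r (randomGammaBridge γ τ t ω) ∂(μ.map τ)) ω) ∧
    (∀ g : ℝ≥0 → ℝ → ℝ, Measurable (fun p : Set.Ioi (0 : ℝ≥0) × ℝ => g p.1 p.2) →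
      (∃ C, ∀ r y, 0 < r → |g r y| ≤ C) →
      (μ[fun ω => g (τ ω) (randomGammaBridge γ τ t ω) |
          completedNatural (randomGammaBridge γ τ) μ t] =ᵐ[μ]
        fun ω =>
          {ω | randomGammaBridge γ τ t ω = 1}.indicator (fun ω => g (min (τ ω) t) 1) ω +
          {ω | randomGammaBridge γ τ t ω ∈ Set.Ioo 0 1}.indicator (fun ω =>
            ∫ r in Set.Ioi t,
              g r (randomGammaBridge γ τ t ω) *
                bayesWeight (μ.map τ) t r (randomGammaBridge γ τ t ω) ∂(μ.map τ)) ω) ∧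
      (μ[fun ω => g (τ ω) (randomGammaBridge γ τ u ω) |
          completedNatural (randomGammaBridge γ τ) μ t] =ᵐ[μ]
        fun ω =>
          {ω | randomGammaBridge γ τ t ω = 1}.indicator (fun ω => g (min (τ ω) t) 1) ω +
          {ω | randomGammaBridge γ τ t ω ∈ Set.Ioo 0 1}.indicator (fun ω =>
            ∫ r in Set.Ioc t u,
              g r 1 * bayesWeight (μ.map τ) t r (randomGammaBridge γ τ t ω) ∂(μ.map τ)) ω +
          {ω | randomGammaBridge γ τ t ω ∈ Set.Ioo 0 1}.indicator (fun ω =>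
            ∫ r in Set.Ioi u,
              (∫ y, g r y ∂(bridgeTransition t u r (randomGammaBridge γ τ t ω))) *
                bayesWeight (μ.map τ) t r (randomGammaBridge γ τ t ω) ∂(μ.map τ)) ω)) := by
  -- The present-time formula contains (i), as the case of `g` constant in its second variable.
  have hpresent : ∀ g : ℝ≥0 → ℝ → ℝ, Measurable (fun p : Set.Ioi (0 : ℝ≥0) × ℝ => g p.1 p.2) →
      (∃ C, ∀ r y, 0 < r → |g r y| ≤ C) →
      μ[fun ω => g (τ ω) (randomGammaBridge γ τ t ω) |
          completedNatural (randomGammaBridge γ τ) μ t] =ᵐ[μ]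
        fun ω =>
          {ω | randomGammaBridge γ τ t ω = 1}.indicator (fun ω => g (min (τ ω) t) 1) ω +
          {ω | randomGammaBridge γ τ t ω ∈ Set.Ioo 0 1}.indicator (fun ω =>
            ∫ r in Set.Ioi t,
              g r (randomGammaBridge γ τ t ω) *
                bayesWeight (μ.map τ) t r (randomGammaBridge γ τ t ω) ∂(μ.map τ)) ω := by
    intro g hg hC
    -- The extension is harmless: `g` is only evaluated at the positive lengths `τ`, `τ ∧ t` and `r
    -- > t`.
    obtain ⟨g', M, hM0, hg', hM, heq⟩ := exists_bounded_measurable_extension hg hC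
    have h := condExp_randomGammaBridge hγ hτ hτpos hindep ht htu
      (F := fun p => g' p.1 p.2.1) (G := g')
      (hg'.comp (f := fun p : ℝ≥0 × ℝ × ℝ => (p.1, p.2.1)) (by fun_prop)) hg' hM0
      (fun p => hM _ _) hM (isBridgeMean_present hγ ht hg')
    have e : ∀ ω, g' (τ ω) (randomGammaBridge γ τ t ω) = g (τ ω) (randomGammaBridge γ τ t ω) :=
      fun ω => heq _ (hτpos ω) _
    simp only [e] at h
    refine h.trans (Filter.Eventually.of_forall fun ω => ?_)
    simp only
    congr 2
    · ext ω
      exact heq _ (lt_min (hτpos ω) ht) _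
    · ext ω
      refine setIntegral_congr_fun measurableSet_Ioi fun r hr => ?_
      rw [heq r (ht.trans hr)]
  refine ⟨fun g hg ⟨C, hC⟩ => ?_, fun g hg hC => ⟨hpresent g hg hC, ?_⟩⟩
  · exact hpresent (fun r _ => g r) (hg.comp measurable_fst) ⟨C, fun r _ hr => hC r hr⟩
  · obtain ⟨g', M, hM0, hg', hM, heq⟩ := exists_bounded_measurable_extension hg hC
    have hG := measurable_bridgeFutureMean (t := t) (u := u) hg'
    have hGM := abs_bridgeFutureMean_le htu hM
    have h := condExp_randomGammaBridge hγ hτ hτpos hindep ht htu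
      (F := fun p => g' p.1 p.2.2) (G := bridgeFutureMean t u g')
      (hg'.comp (f := fun p : ℝ≥0 × ℝ × ℝ => (p.1, p.2.2)) (by fun_prop)) hG hM0
      (fun p => hM _ _) hGM (isBridgeMean_future hγ ht htu hg' hM)
    have e : ∀ ω, g' (τ ω) (randomGammaBridge γ τ u ω) = g (τ ω) (randomGammaBridge γ τ u ω) :=
      fun ω => heq _ (hτpos ω) _
    simp only [e] at h
    refine h.trans (Filter.Eventually.of_forall fun ω => ?_)
    simp only
    rw [add_assoc]
    congr 1
    · congr 1
      ext ω
      exact heq _ (lt_min (hτpos ω) ht) _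
    · by_cases hω : randomGammaBridge γ τ t ω ∈ Set.Ioo 0 1
      · simp only [Set.indicator, Set.mem_ofPred_eq, hω, if_true]
        rw [bayesMean_eq_add htu hG hGM]
        congr 1
        · refine setIntegral_congr_fun measurableSet_Ioc fun r hr => ?_
          simp only [bridgeFutureMean, if_pos hr.2]
          rw [heq r (ht.trans hr.1)]
        · refine setIntegral_congr_fun measurableSet_Ioi fun r hr => ?_
          rw [bridgeFutureMean_eq_integral htu hg' hr hω.2]
          simp only [heq r ((ht.trans htu).trans hr)]
      · simp only [Set.indicator, Set.mem_ofPred_eq, hω, if_false, add_zero]
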